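/- All manifolds and submanifolds are smooth; submanifolds of $\mathbb{R}^n$ are embedded and without boundary, but need not be closed subsets. An $(n-1)$-dimensional submanifold $A \subset \mathbb{R}^n$ is said to \emph{nicely bound} a closed subset $D \subset \mathbb{R}^n$ if 1. $D = \overline{A} - A$; 2. each connected component of $\overline{A}$ contains exactly one connected component of $D$; 3. $D$ is the closure of an $(n-2)$-dimensional submanifold $D_0 \subset \mathbb{R}^n$ such that $D - D_0$ has codimension at least $4$ in $\mathbb{R}^n$ (that is, it is empty or has Hausdorff dimension at most $n-4$) and $\overline{A}$ is locally diffeomorphic to a half space along $D_0$: every point of $D_0$ has a neighbourhood with smooth coordinates $y_1,\dots,y_n$ of $\mathbb{R}^n$ in which $\overline{A}$ is given by $y_{n-1} \ge 0,\ y_n = 0$ and $D_0$ by $y_{n-1} = y_n = 0$. **Theorem.** Let $X$ be a connected (Hausdorff, second countable) $n$-manifold with $H_1(X, \mathbb{Z}) = 0$, let $F : X \to \mathbb{R}^n$ be a local diffeomorphism, and let $D \subset \mathbb{R}^n$ be a closed set such that the restriction $X - F^{-1}(D) \to \mathbb{R}^n - D$ of $F$ is a $d$-sheeted covering map, where $d$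 is a natural number or $\infty$. Suppose that $D$ is nicely bounded by a connected $(n-1)$-dimensional submanifold $A \subset \mathbb{R}^n$ such that $\mathbb{R}^n - \overline{A}$ is simply connected. Then $d = 1$, $d = 2$ or $d = \infty$. -/

import Mathlib

open scoped Manifold ContDiff ENNReal

universe u

/-- A smooth local coordinate system of `ℝⁿ`: a homeomorphism between open subsets of `ℝⁿ` that is
`C^∞` in both directions, i.e. a diffeomorphism between open subsets of `ℝⁿ`. -/
def IsSmoothChart {n : ℕ}
    (φ : OpenPartialHomeomorph (EuclideanSpace ℝ (Fin n)) (EuclideanSpace ℝ (Fin n))) : Prop :=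
  ContDiffOn ℝ ∞ φ φ.source ∧ ContDiffOn ℝ ∞ φ.symm φ.target

/-- `S` is a smooth (embedded, boundaryless) `m`-dimensional submanifold of `ℝⁿ`: around each of its
points there is a smooth local coordinate system in which `S` is the set where the last `n - m`
coordinates vanish. The dimension is an integer so that `n - 1` and `n - 2` are never truncated;
only the empty set is a submanifold of negative dimension. -/
def IsSubmanifold {n : ℕ} (m : ℤ) (S : Set (EuclideanSpace ℝ (Fin n))) : Prop :=
  ∀ p ∈ S, 0 ≤ m ∧ m ≤ n ∧
    ∃ φ : OpenPartialHomeomorph (EuclideanSpace ℝ (Fin n)) (EuclideanSpace ℝ (Fin n)),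
      IsSmoothChart φ ∧ p ∈ φ.source ∧
        ∀ x ∈ φ.source, x ∈ S ↔ ∀ i : Fin n, m ≤ (i : ℤ) → φ x i = 0

/-- `S ⊆ ℝⁿ` has codimension at least `k`: it is empty or its (Hausdorff) dimension is at most
`n - k`. -/
def HasCodimAtLeast {n : ℕ} (k : ℕ) (S : Set (EuclideanSpace ℝ (Fin n))) : Prop :=
  S.Nonempty → dimH S + (k : ℝ≥0∞) ≤ (n : ℝ≥0∞)

/-- The closed set `B` is locally diffeomorphic to an `(n-1)`-dimensional half space along `D₀`:
around each point of `D₀` there is a smooth local coordinate system of `ℝⁿ` which carries `B` to the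
half space `{y | 0 ≤ y i, y j = 0}` and `D₀` to the boundary `{y | y i = 0, y j = 0}` of it. -/
def IsHalfSpaceAlong {n : ℕ} (B D₀ : Set (EuclideanSpace ℝ (Fin n))) : Prop :=
  ∀ p ∈ D₀, ∃ φ : OpenPartialHomeomorph (EuclideanSpace ℝ (Fin n)) (EuclideanSpace ℝ (Fin n)),
    IsSmoothChart φ ∧ p ∈ φ.source ∧ ∃ i j : Fin n, i ≠ j ∧
      (∀ x ∈ φ.source, x ∈ B ↔ 0 ≤ φ x i ∧ φ x j = 0) ∧
      (∀ x ∈ φ.source, x ∈ D₀ ↔ φ x i = 0 ∧ φ x j = 0)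

/-- The `(n-1)`-submanifold `A ⊆ ℝⁿ` nicely bounds the closed set `D ⊆ ℝⁿ`. -/
structure NicelyBounds {n : ℕ} (A D : Set (EuclideanSpace ℝ (Fin n))) : Prop where
  /-- `D` is the boundary `closure A - A` of `A`. -/
  eq_boundary : D = closure A \ A
  /-- Each connected component of `closure A` contains exactly one connected component of `D`. -/
  component : ∀ x ∈ closure A, ∃! C : Set (EuclideanSpace ℝ (Fin n)),
    (∃ y ∈ D, C = connectedComponentIn D y) ∧ C ⊆ connectedComponentIn (closure A) x
  /-- `D` is the closure of an `(n-2)`-submanifold `D₀` along which `closure A` is locally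
  diffeomorphic to a half space, and `D - D₀` has codimension at least `4`. -/
  regular : ∃ D₀ : Set (EuclideanSpace ℝ (Fin n)), D = closure D₀ ∧
    IsSubmanifold ((n : ℤ) - 2) D₀ ∧ HasCodimAtLeast 4 (D \ D₀) ∧
    IsHalfSpaceAlong (closure A) D₀

/-- `H₁(X, ℤ) = 0`, for singular homology. -/
def VanishingH1 (X : Type u) [TopologicalSpace X] : Prop :=
  CategoryTheory.Limits.IsZero
    (((AlgebraicTopology.singularHomologyFunctor (ModuleCat.{u} ℤ) 1).obj
      (ModuleCat.of ℤ (ULift.{u} ℤ))).obj (TopCat.of X))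

/-- The restriction `X - F⁻¹(D) → Y - D` is a `d`-sheeted covering map (`d = ⊤`: infinitely many
sheets). -/
def IsSheetedCoverAwayFrom {X Y : Type*} [TopologicalSpace X] [TopologicalSpace Y]
    (F : X → Y) (D : Set Y) (d : ℕ∞) : Prop :=
  IsCoveringMap (Dᶜ.restrictPreimage F) ∧ ∀ y ∉ D, (F ⁻¹' {y}).encard = d

/-! Write `B` for the closure of `A`. The complement of `B` is simply connected, so over it the
covering splits into `d` sheets. Crossing `A` permutes the sheets. Because `A` is connected, the
crossing permutation `σ₀` is the same everywhere up to inversion, the inversion reflecting the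
choice of the side from which `A` is crossed (`HasCrossingBoxes.exists_perm`). Because `X` is
connected, `σ₀` acts transitively: near `D₀` the complement of `B` is connected, and `D - D₀` is too
thin to separate anything, so only crossings of `A` lead from one sheet to another
(`IsSheetLabel.eq_empty_or_eq_univ`).

If `F` meets `D`, it meets `D₀`, its image being open. A local section there can be followed around
the edge `D₀` from one side of `A` to the other without crossing `A`, so `σ₀` fixes a sheet, and
transitivity gives `d = 1`.

Suppose that `F` misses `D`. If `σ₀ = σ₀⁻¹`, a transitive orbit has at most two elements. Otherwise,
demanding that the crossing be `σ₀` and not its inverse co-orients `A` consistently. Counting signed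
crossings of the closed hypersurface `F⁻¹(A)` is then an integer cocycle on `X`, a coboundary
because `H₁(X, ℤ) = 0` (`VanishingH1.exists_coboundary`). Its primitive assigns to each sheet an
integer that `σ₀` raises by one (`IsSheetLabel.exists_height`), which is impossible for finitely
many sheets. -/

/-! ### Integer cocycles on a space with vanishing first homology -/

open CategoryTheory Limits Simplicial in
/-- If the first homology of a simplicial set vanishes, a `1`-cocycle vanishes on each edge that is
a loop. -/
theorem SSet.cocycle_eq_zero_of_isZero_homology (S : SSet.{u})
    (h : IsZero (S.homology (ModuleCat.of ℤ (ULift.{u} ℤ)) 1)) (φ : S _⦋1⦌ → ℤ)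
    (hφ : ∀ t : S _⦋2⦌, φ (S.δ 0 t) - φ (S.δ 1 t) + φ (S.δ 2 t) = 0)
    (s : S _⦋1⦌) (hs : S.δ 0 s = S.δ 1 s) : φ s = 0 := by
  set R : ModuleCat.{u} ℤ := ModuleCat.of ℤ (ULift.{u} ℤ)
  have hex := (HomologicalComplex.exactAt_iff_isZero_homology (S.chainComplex R) 1).2 h
  rw [HomologicalComplex.exactAt_iff' _ 2 1 0 (by simp) (by simp),
    ShortComplex.moduleCat_exact_iff] at hex
  -- The linear extension of `φ` to 1-chains; the cocycle identity says that it kills boundaries.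
  let Φ : (S.chainComplex R).X 1 ⟶ R := Cofan.IsColimit.desc (S.isColimitChainComplexXCofan R 1)
    fun s ↦ φ s • 𝟙 R
  have hΦ (s : S _⦋1⦌) : S.ιChainComplex s ≫ Φ = φ s • 𝟙 R :=
    Cofan.IsColimit.fac (S.isColimitChainComplexXCofan R 1) _ s
  have hd : (S.chainComplex R).d 2 1 ≫ Φ = 0 := by
    refine SSet.chainComplex_hom_ext fun t ↦ ?_
    rw [SSet.ιChainComplex_d_assoc]
    simp only [Preadditive.sum_comp, Linear.smul_comp, hΦ, comp_zero]
    trans (φ (S.δ 0 t) - φ (S.δ 1 t) + φ (S.δ 2 t)) • 𝟙 R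
    · simp [Fin.sum_univ_succ, add_smul, sub_smul]
      abel
    · rw [hφ, zero_smul]
  -- A loop edge is a cycle, hence by exactness a boundary.
  obtain ⟨c, hc⟩ := hex ((S.ιChainComplex s : R ⟶ (S.chainComplex R).X 1) (ULift.up 1)) (by
    have : S.ιChainComplex s ≫ (S.chainComplex R).d 1 0 = (0 : R ⟶ _) := by
      rw [SSet.ιChainComplex_d]
      simp [Fin.sum_univ_succ, hs]
    exact congr($this (ULift.up 1)))
  have h1 := congr($hd c)
  have h2 := congr($(hΦ s) (ULift.up 1))
  have h3 : Φ ((S.chainComplex R).d 2 1 c) = Φ ((S.ιChainComplex s : R ⟶ _) (ULift.up 1)) :=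
    congr(Φ $hc)
  have h4 : φ s • (ULift.up 1 : ULift.{u} ℤ) = 0 := h2.symm.trans (h3.symm.trans h1)
  simpa using congr(ULift.down $h4)

/-- The class in a simply connected space of the paths between two points. -/
noncomputable def SimplyConnectedSpace.pathClass {Δ : Type*} [TopologicalSpace Δ]
    [SimplyConnectedSpace Δ] (a b : Δ) : Path.Homotopic.Quotient a b :=
  .mk (PathConnectedSpace.somePath a b)

theorem SimplyConnectedSpace.eq_pathClass {Δ : Type*} [TopologicalSpace Δ]
    [SimplyConnectedSpace Δ] {a b : Δ} (q : Path.Homotopic.Quotient a b) :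
    q = pathClass a b :=
  Subsingleton.elim _ _

theorem Path.Homotopic.Quotient.map_trans {X Y : Type*} [TopologicalSpace X] [TopologicalSpace Y]
    {x y z : X} (p : Path.Homotopic.Quotient x y) (q : Path.Homotopic.Quotient y z) (σ : C(X, Y)) :
    (p.trans q).map σ = (p.map σ).trans (q.map σ) := by
  obtain ⟨p⟩ := p
  obtain ⟨q⟩ := q
  exact congr_arg Path.Homotopic.Quotient.mk (Path.map_trans p q σ.continuous)

open CategoryTheory Simplicial in
/-- If `H₁(X, ℤ) = 0`, every additive integer valued function of homotopy classes of paths vanishes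
on loops. -/
theorem VanishingH1.eq_zero_of_loop {X : Type u} [TopologicalSpace X] (hX : VanishingH1 X)
    (f : ∀ x y : X, Path.Homotopic.Quotient x y → ℤ)
    (hf : ∀ {x y z : X} (p : Path.Homotopic.Quotient x y) (q : Path.Homotopic.Quotient y z),
      f x z (p.trans q) = f x y p + f y z q)
    (x : X) (q : Path.Homotopic.Quotient x x) : f x x q = 0 := by
  have hΔ (n : ℕ) : SimplyConnectedSpace (stdSimplex ℝ (Fin (n + 1))) :=
    have := (convex_stdSimplex ℝ (Fin (n + 1))).contractibleSpace ⟨_, single_mem_stdSimplex ℝ 0⟩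
    inferInstance
  -- A simply connected `Δ` has a single path class from `a` to `b`, so `G` is additive in the
  -- endpoints and natural in `Δ`. On 2-simplices, additivity is the cocycle identity.
  let G {Δ : Type} [TopologicalSpace Δ] [SimplyConnectedSpace Δ] (σ : C(Δ, X)) (a b : Δ) : ℤ :=
    f (σ a) (σ b) ((SimplyConnectedSpace.pathClass a b).map σ)
  have hG_add {Δ : Type} [TopologicalSpace Δ] [SimplyConnectedSpace Δ] (σ : C(Δ, X)) (a b c : Δ) :
      G σ a c = G σ a b + G σ b c := by
    simp only [G]
    rw [← hf, ← Path.Homotopic.Quotient.map_trans]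
    exact congr_arg (fun q ↦ f _ _ (q.map σ)) (SimplyConnectedSpace.eq_pathClass _).symm
  have hG_comp {Δ Δ' : Type} [TopologicalSpace Δ] [SimplyConnectedSpace Δ] [TopologicalSpace Δ']
      [SimplyConnectedSpace Δ'] (μ : C(Δ', Δ)) (σ : C(Δ, X)) (a b : Δ') :
      G (σ.comp μ) a b = G σ (μ a) (μ b) := by
    simp only [G]
    rw [← SimplyConnectedSpace.eq_pathClass ((SimplyConnectedSpace.pathClass a b).map μ)]
    congr 1
  let S := TopCat.toSSet.obj (TopCat.of X)
  let e (n : ℕ) : S.obj (.op ⦋n⦌) ≃ C(stdSimplex ℝ (Fin (n + 1)), X) := TopCat.toSSetObjEquiv _ _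
  let μ (n : ℕ) (i : Fin (n + 2)) : C(stdSimplex ℝ (Fin (n + 1)), stdSimplex ℝ (Fin (n + 2))) :=
    ⟨_, stdSimplex.continuous_map i.succAbove⟩
  have he (n : ℕ) (i : Fin (n + 2)) (t : S _⦋n + 1⦌) : e n (S.δ i t) = (e (n + 1) t).comp (μ n i) :=
    rfl
  have key (s : S _⦋1⦌) (hs : S.δ 0 s = S.δ 1 s) :
      G (e 1 s) (stdSimplex.vertex 0) (stdSimplex.vertex 1) = 0 := by
    refine SSet.cocycle_eq_zero_of_isZero_homology S hX
      (fun s ↦ G (e 1 s) (stdSimplex.vertex 0) (stdSimplex.vertex 1)) (fun t ↦ ?_) s hs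
    have hμ (i : Fin 3) (j : Fin 2) : μ 1 i (stdSimplex.vertex j) =
        stdSimplex.vertex (i.succAbove j) := stdSimplex.map_vertex _ _
    simp only [he, hG_comp, hμ]
    have := hG_add (e 2 t) (stdSimplex.vertex 0) (stdSimplex.vertex 1) (stdSimplex.vertex 2)
    change G _ (stdSimplex.vertex 1) (stdSimplex.vertex 2) -
      G _ (stdSimplex.vertex 0) (stdSimplex.vertex 2) +
      G _ (stdSimplex.vertex 0) (stdSimplex.vertex 1) = 0
    linarith
  obtain ⟨γ⟩ := q
  obtain ⟨γ, h0, h1⟩ := γ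
  subst h0
  have hI : SimplyConnectedSpace unitInterval :=
    have := (convex_Icc (0 : ℝ) 1).contractibleSpace ⟨0, by simp⟩
    inferInstanceAs (SimplyConnectedSpace (Set.Icc (0 : ℝ) 1))
  let m : C(stdSimplex ℝ (Fin 2), unitInterval) := stdSimplexHomeomorphUnitInterval
  have hs (i : Fin 2) (a : stdSimplex ℝ (Fin 1)) :
      m (μ 0 i a) = if i = 0 then 1 else 0 := by
    obtain rfl : a = stdSimplex.vertex 0 := Subsingleton.elim _ _
    have : μ 0 i (stdSimplex.vertex 0) = stdSimplex.vertex (i.succAbove 0) :=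
      stdSimplex.map_vertex _ _
    rw [this]
    fin_cases i
    · exact stdSimplexHomeomorphUnitInterval_one
    · exact stdSimplexHomeomorphUnitInterval_zero
  have hloop := key ((e 1).symm (γ.comp m)) (by
    apply (e 0).injective
    rw [he, he, Equiv.apply_symm_apply]
    ext a
    simpa [hs] using h1)
  rw [Equiv.apply_symm_apply, hG_comp] at hloop
  have hm0 : m (stdSimplex.vertex 0) = 0 := stdSimplexHomeomorphUnitInterval_zero
  have hm1 : m (stdSimplex.vertex 1) = 1 := stdSimplexHomeomorphUnitInterval_one
  rw [hm0, hm1] at hloop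
  -- The endpoint of `γ` equals the base point only propositionally; this moves `f` between the two
  -- types.
  have hcast (y : X) (h : γ 1 = y) : f (γ 0) y (.mk ⟨γ, rfl, h⟩) =
      f (γ 0) (γ 1) (.mk ⟨γ, rfl, rfl⟩) := by
    subst h; rfl
  refine (hcast _ h1).trans (Eq.trans ?_ hloop)
  simp only [G]
  rw [← SimplyConnectedSpace.eq_pathClass (a := (0 : unitInterval)) (b := 1)
    (.mk ⟨.id _, rfl, rfl⟩)]
  rfl

open Filter Topology Set Module

/-- The principal `ℤ`-bundle of a locally constant `ℤ`-valued Čech cocycle. -/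
noncomputable def FiberBundleCore.ofIntCocycle {X ι : Type*} [TopologicalSpace X] (N : ι → Set X)
    (hN : ∀ i, IsOpen (N i)) (hcov : ∀ x, ∃ i, x ∈ N i) (c : ι → ι → X → ℤ)
    (hc : ∀ i j, ∀ x ∈ N i ∩ N j, ∀ᶠ y in 𝓝 x, c i j y = c i j x)
    (hadd : ∀ i j k, ∀ x ∈ N i ∩ N j ∩ N k, c i j x + c j k x = c i k x) :
    FiberBundleCore ι X ℤ where
  baseSet := N
  isOpen_baseSet := hN
  indexAt x := (hcov x).choose
  mem_baseSet_at x := (hcov x).choose_spec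
  coordChange i j x v := v + c i j x
  coordChange_self i x hx v := by
    have := hadd i i i x ⟨⟨hx, hx⟩, hx⟩
    lia
  continuousOn_coordChange i j := by
    rintro ⟨x, v⟩ ⟨hx, -⟩
    refine (continuousAt_snd.add ?_).continuousWithinAt
    refine continuousAt_const.congr (f := fun _ ↦ c i j x) ?_
    filter_upwards [continuousAt_fst.eventually (hc i j x hx)] with p hp using hp.symm
  coordChange_comp i j k x hx v := by rw [add_assoc, hadd i j k x hx]

/-- If `H₁(X, ℤ) = 0`, every locally constant `ℤ`-valued Čech `1`-cocycle is a coboundary. -/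
theorem VanishingH1.exists_coboundary {X : Type u} [TopologicalSpace X] [ConnectedSpace X]
    [LocallyPathConnectedSpace X] (hX : VanishingH1 X) {ι : Type*} (N : ι → Set X)
    (hN : ∀ i, IsOpen (N i)) (hcov : ∀ x, ∃ i, x ∈ N i) (c : ι → ι → X → ℤ)
    (hc : ∀ i j, ∀ x ∈ N i ∩ N j, ∀ᶠ y in 𝓝 x, c i j y = c i j x)
    (hadd : ∀ i j k, ∀ x ∈ N i ∩ N j ∩ N k, c i j x + c j k x = c i k x) :
    ∃ g : ι → X → ℤ, (∀ i, ∀ x ∈ N i, ∀ᶠ y in 𝓝 x, g i y = g i x) ∧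
      ∀ i j, ∀ x ∈ N i ∩ N j, g j x = g i x + c i j x := by
  have : PathConnectedSpace X := .of_locallyPathConnectedSpace
  -- The total space covers `X`, and a primitive of `c` is a global section read in the local
  -- trivialisations. The section exists once the holonomy around loops vanishes.
  let Z := FiberBundleCore.ofIntCocycle N hN hcov c hc hadd
  let p : Z.TotalSpace → X := Bundle.TotalSpace.proj
  have cov : IsCoveringMap p := FiberBundle.isCoveringMap (F := ℤ) (E := Z.Fiber)
  have hcoord (i : ι) (x : X) (v : ℤ) :
      (Z.localTriv i ⟨x, v⟩).2 = v + c (Z.indexAt x) i x := rfl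
  let deck (k : ℤ) (e : Z.TotalSpace) : Z.TotalSpace := ⟨e.1, HAdd.hAdd (α := ℤ) (β := ℤ) e.2 k⟩
  have hdeck (k : ℤ) : Continuous (deck k) := by
    refine continuous_iff_continuousAt.2 fun e ↦ (FiberBundle.continuousAt_totalSpace ℤ _).2
      ⟨cov.continuous.continuousAt, ?_⟩
    have h := ((FiberBundle.continuousAt_totalSpace ℤ (id : Z.TotalSpace → _)).1
      (continuousAt_id (x := e))).2
    refine (h.add (continuousAt_const (y := k))).congr (.of_forall fun e' ↦ ?_)
    obtain ⟨x', v⟩ := e'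
    exact add_right_comm (G := ℤ) v _ k
  have hmon {x y : X} (q : Path.Homotopic.Quotient x y) (v k : ℤ) :
      (cov.monodromy q ⟨⟨x, (v + k : ℤ)⟩, rfl⟩).1 =
        deck k (cov.monodromy q ⟨⟨x, v⟩, rfl⟩).1 := by
    obtain ⟨γ⟩ := q
    let Γ := cov.liftPath γ ⟨x, v⟩ γ.source
    have h : (⟨deck k, hdeck k⟩ : C(_, _)).comp Γ = cov.liftPath γ ⟨x, (v + k : ℤ)⟩ γ.source :=
      (cov.eq_liftPath_iff' _).2 ⟨cov.liftPath_lifts γ ⟨x, v⟩ γ.source,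
        congr_arg (deck k) (cov.liftPath_zero γ ⟨x, v⟩ γ.source)⟩
    exact congr($h.symm 1)
  -- Monodromy commutes with the translations `deck k`, so along a path it is addition of one
  -- integer, additive under concatenation.
  let hol (x y : X) (q : Path.Homotopic.Quotient x y) : ℤ :=
    (cov.monodromy q ⟨⟨x, (0 : ℤ)⟩, rfl⟩).1.2
  have hhol {x y : X} (q : Path.Homotopic.Quotient x y) (v : ℤ) :
      cov.monodromy q ⟨⟨x, v⟩, rfl⟩ = ⟨⟨y, (v + hol x y q : ℤ)⟩, rfl⟩ := by
    apply Subtype.ext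
    have h := hmon q 0 v
    rw [zero_add] at h
    rw [h]
    have hy (e : p ⁻¹' {y}) : deck v e.1 = ⟨y, HAdd.hAdd (α := ℤ) (β := ℤ) v e.1.2⟩ := by
      obtain ⟨⟨y', w⟩, rfl⟩ := e
      exact congr_arg (Bundle.TotalSpace.mk y') (add_comm (G := ℤ) w v)
    exact hy _
  have hloop := hX.eq_zero_of_loop hol (fun {x y z} q r ↦ by
    have h1 := cov.monodromy_trans_apply q r ⟨⟨x, (0 : ℤ)⟩, rfl⟩
    rw [hhol, hhol, hhol] at h1
    have h2 := congr_arg Subtype.val h1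
    rw [zero_add, zero_add] at h2
    exact eq_of_heq (Bundle.TotalSpace.mk.inj h2).2)
  obtain ⟨x₀⟩ : Nonempty X := inferInstance
  -- With trivial holonomy every loop of `X` lifts to a loop, so the lifting criterion applies to
  -- the identity of `X`.
  obtain ⟨s, ⟨-, hs⟩, -⟩ := cov.existsUnique_continuousMap_lifts_of_range_le (f := .id X)
    (a₀ := x₀) (e₀ := ⟨x₀, (0 : ℤ)⟩) rfl (by
      rintro - ⟨q, rfl⟩
      have hq : cov.monodromy q ⟨⟨x₀, (0 : ℤ)⟩, rfl⟩ = ⟨⟨x₀, (0 : ℤ)⟩, rfl⟩ := by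
        rw [hhol, hloop]; rfl
      have hl := cov.map_liftPathQuotient q ⟨⟨x₀, (0 : ℤ)⟩, rfl⟩
      generalize cov.liftPathQuotient q ⟨⟨x₀, (0 : ℤ)⟩, rfl⟩ = r at hl
      generalize_proofs hp at hl
      revert r hl hp
      rw [hq]
      intro r _ _ _ hl
      refine ⟨r, ?_⟩
      refine (FundamentalGroup.mapOfEq_apply _ _ _).trans
        ((congr_arg (Path.Homotopic.Quotient.cast · rfl rfl) hl).trans ?_)
      obtain ⟨γ⟩ := q
      rfl)
  have hs' (x : X) : (s x).1 = x := congr_fun hs x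
  refine ⟨fun i x ↦ (Z.localTriv i (s x)).2, fun i x hx ↦ ?_, fun i j x hx ↦ ?_⟩
  · have h : ContinuousAt (fun x ↦ (Z.localTriv i (s x)).2) x :=
      continuousAt_snd.comp (((Z.localTriv i).continuousAt
        ((Z.mem_localTriv_source i _).2 (by rwa [hs']))).comp s.continuous.continuousAt)
    exact h.eventually (p := fun v ↦ v = _) (by rw [nhds_discrete]; exact rfl)
  · rcases hv : s x with ⟨y, v⟩
    obtain rfl : y = x := by simpa [hv] using hs' x
    simp only [hv]
    rw [show (Z.localTriv j ⟨y, v⟩).2 = _ from hcoord j y v,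
      show (Z.localTriv i ⟨y, v⟩).2 = _ from hcoord i y v,
      ← hadd _ i j y ⟨⟨Z.mem_baseSet_at _, hx.1⟩, hx.2⟩]
    exact (add_assoc (G := ℤ) _ _ _).symm

/-! ### Local geometry of hypersurfaces and their boundaries -/

/-- An open convex set stays connected when a closed set of codimension greater than one is removed
from it. -/
theorem Convex.isPreconnected_diff_of_dimH_lt {E : Type*} [NormedAddCommGroup E]
    [InnerProductSpace ℝ E] [FiniteDimensional ℝ E] {B Z : Set E} (hB : Convex ℝ B)
    (hBo : IsOpen B) (hZ : IsClosed Z) (hdim : dimH Z + 1 < finrank ℝ E) :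
    IsPreconnected (B \ Z) := by
  refine isPreconnected_of_forall_pair fun x hx y hy ↦ ?_
  obtain ⟨ε, hε, hx', hy'⟩ : ∃ ε > 0, Metric.ball x ε ⊆ B \ Z ∧ Metric.ball y ε ⊆ B \ Z := by
    obtain ⟨ε₁, h₁, hx'⟩ := Metric.isOpen_iff.1 (hBo.sdiff hZ) x hx
    obtain ⟨ε₂, h₂, hy'⟩ := Metric.isOpen_iff.1 (hBo.sdiff hZ) y hy
    exact ⟨min ε₁ ε₂, lt_min h₁ h₂, (Metric.ball_subset_ball (min_le_left _ _)).trans hx',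
      (Metric.ball_subset_ball (min_le_right _ _)).trans hy'⟩
  -- Projecting along `y - x` does not raise the dimension of `Z`, so the shadow of `Z` in `K` has
  -- dense complement. A small shift `w ∈ K` therefore moves the segment from `x` to `y` off `Z`.
  let K := (ℝ ∙ (y - x))ᗮ
  have hK : dimH (K.orthogonalProjectionOnto '' Z) < finrank ℝ K := by
    have h1 := Submodule.finrank_add_finrank_orthogonal (ℝ ∙ (y - x))
    have h2 : finrank ℝ (ℝ ∙ (y - x)) ≤ 1 := finrank_span_le_card ({y - x} : Set E)
    have h3 : (finrank ℝ E : ℝ≥0∞) ≤ finrank ℝ K + 1 := by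
      norm_cast
      change _ ≤ finrank ℝ (ℝ ∙ (y - x))ᗮ + 1
      lia
    have h4 := hdim.trans_le h3
    exact (dimH_orthogonalProjectionOnto_le K Z).trans_lt (lt_of_add_lt_add_right h4)
  obtain ⟨t, ht, htx⟩ := (dense_compl_of_dimH_lt_finrank hK).exists_dist_lt
    (K.orthogonalProjectionOnto x) hε
  let w : E := t - K.orthogonalProjectionOnto x
  have hwK : w ∈ K := K.sub_mem t.2 (K.orthogonalProjectionOnto x).2
  have hw : ‖w‖ < ε := by
    rw [dist_comm, dist_eq_norm] at htx
    exact htx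
  have hseg : segment ℝ (x + w) (y + w) ⊆ B \ Z := by
    intro z hz
    refine ⟨hB.segment_subset (hx' (by simpa using hw)).1 (hy' (by simpa using hw)).1 hz,
      fun hzZ ↦ ht ⟨z, hzZ, ?_⟩⟩
    rw [segment_eq_image'] at hz
    obtain ⟨θ, -, rfl⟩ := hz
    have h0 : K.orthogonalProjectionOnto (y - x) = 0 :=
      Submodule.orthogonalProjectionOnto_orthogonal_apply_eq_zero (Submodule.mem_span_singleton_self _)
    have hw' : K.orthogonalProjectionOnto w = ⟨w, hwK⟩ :=
      K.orthogonalProjectionOnto_mem_subspace_eq_self ⟨w, hwK⟩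
    rw [add_sub_add_right_eq_sub, map_add, map_add, map_smul, h0, hw', smul_zero, add_zero]
    ext
    simp [w]
  refine ⟨Metric.ball x ε ∪ segment ℝ (x + w) (y + w) ∪ Metric.ball y ε,
    union_subset (union_subset hx' hseg) hy', .inl (.inl (Metric.mem_ball_self hε)),
    .inr (Metric.mem_ball_self hε), ?_⟩
  refine IsPreconnected.union (y + w) (.inr (right_mem_segment ..)) (by simpa using hw) ?_
    (convex_ball y ε).isPreconnected
  exact IsPreconnected.union (x + w) (by simpa using hw) (left_mem_segment ..)
    (convex_ball x ε).isPreconnected (convex_segment ..).isPreconnected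

/-- On the open set `N`, the set `A` is the zero set of the function `h`, and the two sides
`0 < h` and `h < 0` of `A` in `N` are connected and adherent to each point of `A`. -/
structure IsTwoSidedBox {E : Type*} [TopologicalSpace E] (A N : Set E) (h : E → ℝ) : Prop where
  isOpen : IsOpen N
  isPreconnected : IsPreconnected N
  continuousOn : ContinuousOn h N
  mem_iff : ∀ x ∈ N, x ∈ A ↔ h x = 0
  isPreconnected_pos : IsPreconnected {x ∈ N | 0 < h x}
  isPreconnected_neg : IsPreconnected {x ∈ N | h x < 0}
  mem_closure_pos : ∀ x ∈ N, h x = 0 → x ∈ closure {x ∈ N | 0 < h x}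
  mem_closure_neg : ∀ x ∈ N, h x = 0 → x ∈ closure {x ∈ N | h x < 0}

theorem OpenPartialHomeomorph.exists_image_ball_subset {E E' : Type*} [TopologicalSpace E]
    [PseudoMetricSpace E'] (φ : OpenPartialHomeomorph E E') {a : E} (ha : a ∈ φ.source) {W : Set E}
    (hW : W ∈ 𝓝 a) :
    ∃ r > 0, Metric.ball (φ a) r ⊆ φ.target ∧ φ.symm '' Metric.ball (φ a) r ⊆ W ∧
      IsOpen (φ.symm '' Metric.ball (φ a) r) ∧ a ∈ φ.symm '' Metric.ball (φ a) r := by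
  have h : φ.target ∩ φ.symm ⁻¹' W ∈ 𝓝 (φ a) :=
    inter_mem (φ.open_target.mem_nhds (φ.map_source ha))
      ((φ.continuousAt_symm (φ.map_source ha)).preimage_mem_nhds (by rwa [φ.left_inv ha]))
  obtain ⟨r, hr, hb⟩ := Metric.mem_nhds_iff.1 h
  have ht : Metric.ball (φ a) r ⊆ φ.target := hb.trans inter_subset_left
  exact ⟨r, hr, ht, image_subset_iff.2 (hb.trans inter_subset_right),
    φ.symm.isOpen_image_of_subset_source Metric.isOpen_ball ht,
    φ a, Metric.mem_ball_self hr, φ.left_inv ha⟩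

theorem OpenPartialHomeomorph.sep_image_symm {E E' : Type*} [TopologicalSpace E]
    [TopologicalSpace E'] (φ : OpenPartialHomeomorph E E') {B : Set E'} (hB : B ⊆ φ.target)
    (P : E' → Prop) :
    {x ∈ φ.symm '' B | P (φ x)} = φ.symm '' {y ∈ B | P y} := by
  ext x
  constructor
  · rintro ⟨⟨y, hy, rfl⟩, hP⟩
    rw [φ.right_inv (hB hy)] at hP
    exact ⟨y, ⟨hy, hP⟩, rfl⟩
  · rintro ⟨y, ⟨hy, hP⟩, rfl⟩
    exact ⟨⟨y, hy, rfl⟩, by rwa [φ.right_inv (hB hy)]⟩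

theorem OpenPartialHomeomorph.isPreconnected_sep_image_symm {E E' : Type*} [TopologicalSpace E]
    [TopologicalSpace E'] (φ : OpenPartialHomeomorph E E') {B : Set E'} (hB : B ⊆ φ.target)
    {P : E' → Prop} (h : IsPreconnected {y ∈ B | P y}) :
    IsPreconnected {x ∈ φ.symm '' B | P (φ x)} := by
  rw [φ.sep_image_symm hB]
  exact h.image _ (φ.continuousOn_symm.mono ((sep_subset _ _).trans hB))

theorem EuclideanSpace.mem_closure_sep_of_forall {n : ℕ} {B : Set (EuclideanSpace ℝ (Fin n))}
    (hB : IsOpen B) {y : EuclideanSpace ℝ (Fin n)} (hy : y ∈ B) (v : EuclideanSpace ℝ (Fin n))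
    {P : EuclideanSpace ℝ (Fin n) → Prop} (hP : ∀ ε > (0 : ℝ), P (y + ε • v)) :
    y ∈ closure {y ∈ B | P y} := by
  have hc : Tendsto (fun ε : ℝ ↦ y + ε • v) (𝓝[>] 0) (𝓝 y) := by
    have : Continuous fun ε : ℝ ↦ y + ε • v := by fun_prop
    exact (this.tendsto' 0 y (by simp)).mono_left nhdsWithin_le_nhds
  refine mem_closure_of_tendsto hc ?_
  filter_upwards [hc.eventually (hB.mem_nhds hy), self_mem_nhdsWithin] with ε h1 h2
  exact ⟨h1, hP ε h2⟩

/-- The box is a ball in a flattening chart and `h` is the last coordinate, so the two sides are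
convex half balls in the chart. -/
theorem IsSubmanifold.exists_isTwoSidedBox {n : ℕ} {A : Set (EuclideanSpace ℝ (Fin n))}
    (hA : IsSubmanifold ((n : ℤ) - 1) A) {a : EuclideanSpace ℝ (Fin n)} (ha : a ∈ A)
    {W : Set (EuclideanSpace ℝ (Fin n))} (hW : W ∈ 𝓝 a) :
    ∃ N ⊆ W, a ∈ N ∧ ∃ h, IsTwoSidedBox A N h := by
  obtain ⟨h0, -, φ, -, haφ, hφ⟩ := hA a ha
  -- `h0` forces `n ≥ 1`, and `n - 1` is the only index that the submanifold condition constrains.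
  let i : Fin n := ⟨n - 1, by lia⟩
  have hi (x) (hx : x ∈ φ.source) : x ∈ A ↔ φ x i = 0 := by
    rw [hφ x hx]
    refine ⟨fun h ↦ h i (by simp only [i]; lia), fun h j hj ↦ ?_⟩
    obtain rfl : j = i := by ext; have := j.2; simp only [i]; omega
    exact h
  obtain ⟨r, hr, ht, hN, hNo, haN⟩ := φ.exists_image_ball_subset haφ hW
  have hs : φ.symm '' Metric.ball (φ a) r ⊆ φ.source := by
    rintro - ⟨y, hy, rfl⟩
    exact φ.map_target (ht hy)
  have hcl (P : ℝ → Prop) (v : EuclideanSpace ℝ (Fin n)) (hP : ∀ ε > 0, P (ε * v i)) (x)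
      (hx : x ∈ φ.symm '' Metric.ball (φ a) r) (hx0 : φ x i = 0) :
      x ∈ closure {x ∈ φ.symm '' Metric.ball (φ a) r | P (φ x i)} := by
    rw [φ.sep_image_symm ht (fun y ↦ P (y i))]
    obtain ⟨y, hy, rfl⟩ := hx
    rw [φ.right_inv (ht hy)] at hx0
    refine (φ.continuousAt_symm (ht hy)).continuousWithinAt.mem_closure_image ?_
    refine EuclideanSpace.mem_closure_sep_of_forall Metric.isOpen_ball hy v fun ε hε ↦ ?_
    simpa [hx0] using hP ε hε
  refine ⟨_, hN, haN, fun x ↦ φ x i, hNo, ?_, ?_, fun x hx ↦ hi x (hs hx), ?_, ?_, ?_, ?_⟩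
  · exact (convex_ball _ _).isPreconnected.image _ (φ.continuousOn_symm.mono ht)
  · exact (EuclideanSpace.proj (𝕜 := ℝ) i).continuous.comp_continuousOn (φ.continuousOn.mono hs)
  · exact φ.isPreconnected_sep_image_symm ht (P := fun y ↦ 0 < y i) ((convex_ball _ _).inter
      (convex_halfSpace_gt (EuclideanSpace.proj (𝕜 := ℝ) i).isLinear 0)).isPreconnected
  · exact φ.isPreconnected_sep_image_symm ht (P := fun y ↦ y i < 0) ((convex_ball _ _).inter
      (convex_halfSpace_lt (EuclideanSpace.proj (𝕜 := ℝ) i).isLinear 0)).isPreconnected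
  · exact hcl (0 < ·) (EuclideanSpace.single i 1) (by simp)
  · exact hcl (· < 0) (EuclideanSpace.single i (-1)) (by simp)

/-- A half hyperplane does not separate a ball centred on its edge: the complement is a union of
three convex pieces, `y j > 0`, `y i < 0` and `y j < 0`, of which the middle one meets both others.
This is what allows passing around `D₀`. -/
theorem IsHalfSpaceAlong.exists_box {n : ℕ} {B D₀ : Set (EuclideanSpace ℝ (Fin n))}
    (hB : IsHalfSpaceAlong B D₀) {p : EuclideanSpace ℝ (Fin n)} (hp : p ∈ D₀)
    {W : Set (EuclideanSpace ℝ (Fin n))} (hW : W ∈ 𝓝 p) :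
    ∃ V ⊆ W, IsOpen V ∧ p ∈ V ∧ IsPreconnected (V \ B) ∧ (V ∩ (B \ D₀)).Nonempty ∧
      V ∩ closure D₀ ⊆ D₀ := by
  obtain ⟨φ, -, hpφ, i, j, hij, hφB, hφD⟩ := hB p hp
  obtain ⟨r, hr, ht, hN, hNo, haN⟩ := φ.exists_image_ball_subset hpφ hW
  have hs : φ.symm '' Metric.ball (φ p) r ⊆ φ.source := by
    rintro - ⟨y, hy, rfl⟩
    exact φ.map_target (ht hy)
  have hp0 := (hφD p hpφ).1 hp
  have hcl (P : EuclideanSpace ℝ (Fin n) → Prop) (v : EuclideanSpace ℝ (Fin n))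
      (hP : ∀ ε > (0 : ℝ), P (φ p + ε • v)) : {y ∈ Metric.ball (φ p) r | P y}.Nonempty :=
    closure_nonempty_iff.1 ⟨_, EuclideanSpace.mem_closure_sep_of_forall Metric.isOpen_ball
      (Metric.mem_ball_self hr) v hP⟩
  have hpos (k : Fin n) : Convex ℝ {y ∈ Metric.ball (φ p) r | 0 < y k} :=
    (convex_ball _ _).inter (convex_halfSpace_gt (EuclideanSpace.proj (𝕜 := ℝ) k).isLinear 0)
  have hneg (k : Fin n) : Convex ℝ {y ∈ Metric.ball (φ p) r | y k < 0} :=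
    (convex_ball _ _).inter (convex_halfSpace_lt (EuclideanSpace.proj (𝕜 := ℝ) k).isLinear 0)
  refine ⟨_, hN, hNo, haN, ?_, ?_, ?_⟩
  · have h1 : φ.symm '' Metric.ball (φ p) r \ B =
        {x ∈ φ.symm '' Metric.ball (φ p) r | ¬ (0 ≤ φ x i ∧ φ x j = 0)} := by
      ext x
      exact and_congr_right fun hx ↦ not_congr (hφB x (hs hx))
    rw [h1]
    refine φ.isPreconnected_sep_image_symm ht (P := fun y ↦ ¬ (0 ≤ y i ∧ y j = 0)) ?_
    have h2 : {y ∈ Metric.ball (φ p) r | ¬ (0 ≤ y i ∧ y j = 0)} =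
        {y ∈ Metric.ball (φ p) r | 0 < y j} ∪ {y ∈ Metric.ball (φ p) r | y i < 0} ∪
          {y ∈ Metric.ball (φ p) r | y j < 0} := by
      ext y
      simp only [mem_ofPred_eq, mem_union, not_and_or, not_le, ← and_or_left, ← ne_eq,
        ne_iff_lt_or_gt]
      tauto
    rw [h2]
    obtain ⟨y, hy, hy'⟩ := hcl (fun y ↦ 0 < y j ∧ y i < 0)
      (EuclideanSpace.single j 1 - EuclideanSpace.single i 1)
      (by simp [hp0, hij, hij.symm])
    obtain ⟨z, hz, hz'⟩ := hcl (fun y ↦ y i < 0 ∧ y j < 0)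
      (- EuclideanSpace.single j 1 - EuclideanSpace.single i 1)
      (by simp [hp0, hij.symm])
    exact IsPreconnected.union z (.inr ⟨hz, hz'.1⟩) ⟨hz, hz'.2⟩
      (IsPreconnected.union y ⟨hy, hy'.1⟩ ⟨hy, hy'.2⟩ (hpos j).isPreconnected
        (hneg i).isPreconnected) (hneg j).isPreconnected
  · obtain ⟨y, hy, hy'⟩ := hcl (fun y ↦ 0 < y i ∧ y j = 0) (EuclideanSpace.single i 1)
      (by simp [hp0, hij.symm])
    have hyt := ht hy
    refine ⟨φ.symm y, ⟨y, hy, rfl⟩, (hφB _ (φ.map_target hyt)).2 ?_, fun h ↦ ?_⟩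
    · rw [φ.right_inv hyt]
      exact ⟨hy'.1.le, hy'.2⟩
    · have := ((hφD _ (φ.map_target hyt)).1 h).1
      rw [φ.right_inv hyt] at this
      exact hy'.1.ne' this
  · rintro x ⟨hxN, hx⟩
    have hxs := hs hxN
    refine (hφD x hxs).2 ?_
    have hmaps : MapsTo φ (φ.source ∩ D₀) {y | y i = 0 ∧ y j = 0} := fun z hz ↦
      (hφD z hz.1).1 hz.2
    have hclosed : IsClosed {y : EuclideanSpace ℝ (Fin n) | y i = 0 ∧ y j = 0} :=
      (isClosed_eq (by fun_prop) (by fun_prop)).inter (isClosed_eq (by fun_prop) (by fun_prop))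
    have hx' : x ∈ closure (φ.source ∩ D₀) :=
      φ.open_source.inter_closure ⟨hxs, hx⟩
    exact hclosed.closure_subset ((φ.continuousAt hxs).continuousWithinAt.mem_closure hx' hmaps)

/-! ### Local sections and labelling of sheets -/

theorem IsPreconnected.eq_of_eventually_eq {Y S : Type*} [TopologicalSpace Y] {C : Set Y}
    (hC : IsPreconnected C) {f : Y → S} (hf : ∀ y ∈ C, ∀ᶠ y' in 𝓝[C] y, f y' = f y) {y y' : Y}
    (hy : y ∈ C) (hy' : y' ∈ C) : f y = f y' := by
  let _ : TopologicalSpace S := ⊥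
  have : DiscreteTopology S := ⟨rfl⟩
  refine hC.constant (fun y hy ↦ ?_) hy hy'
  exact continuousWithinAt_const.congr_of_eventuallyEq (hf y hy) rfl

/-- `t` is a continuous section of `F` on `N`. -/
structure IsSectionOn {X Y : Type*} [TopologicalSpace X] [TopologicalSpace Y] (F : X → Y)
    (t : Y → X) (N : Set Y) : Prop where
  continuousOn : ContinuousOn t N
  apply_eq : ∀ y ∈ N, F (t y) = y

theorem IsSectionOn.mono {X Y : Type*} [TopologicalSpace X] [TopologicalSpace Y] {F : X → Y}
    {t : Y → X} {N N' : Set Y} (ht : IsSectionOn F t N) (h : N' ⊆ N) : IsSectionOn F t N' :=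
  ⟨ht.continuousOn.mono h, fun y hy ↦ ht.apply_eq y (h hy)⟩

theorem IsSectionOn.eqOn {X Y : Type*} [TopologicalSpace X] [T2Space X] [TopologicalSpace Y]
    {F : X → Y} (hF : IsLocalHomeomorph F) {t t' : Y → X} {N : Set Y} (ht : IsSectionOn F t N)
    (ht' : IsSectionOn F t' N) (hN : IsPreconnected N) {y : Y} (hy : y ∈ N) (h : t y = t' y) :
    EqOn t t' N :=
  (T2Space.isSeparatedMap F).eqOn_of_comp_eqOn hF.isLocallyInjective hN ht.continuousOn
    ht'.continuousOn (fun y hy ↦ (ht.apply_eq y hy).trans (ht'.apply_eq y hy).symm) hy h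

theorem IsLocalHomeomorph.exists_isSectionOn {X Y : Type*} [TopologicalSpace X]
    [TopologicalSpace Y] {F : X → Y} (hF : IsLocalHomeomorph F) (x : X) :
    ∃ V, IsOpen V ∧ F x ∈ V ∧ ∃ t, IsSectionOn F t V ∧ t (F x) = x ∧
      ∀ᶠ x' in 𝓝 x, t (F x') = x' := by
  obtain ⟨e, hx, rfl⟩ := hF x
  exact ⟨e.target, e.open_target, e.map_source hx, e.symm,
    ⟨e.continuousOn_symm, fun y hy ↦ e.right_inv hy⟩, e.left_inv hx,
    (e.open_source.eventually_mem hx).mono fun x' hx' ↦ e.left_inv hx'⟩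

/-- `ℓ` labels the sheets over `U` of the map `F`: it identifies the restriction of `F` over `U`
with a projection `U × S → U`, where each copy of `U` is connected. -/
structure IsSheetLabel {X Y S : Type*} [TopologicalSpace X] (F : X → Y)
    (U : Set Y) (ℓ : X → S) : Prop where
  eventually_eq : ∀ x, F x ∈ U → ∀ᶠ x' in 𝓝 x, ℓ x' = ℓ x
  inj : ∀ x x', F x ∈ U → F x = F x' → ℓ x = ℓ x' → x = x'
  surj : ∀ y ∈ U, ∀ s, ∃ x, F x = y ∧ ℓ x = s
  isPreconnected : ∀ s, IsPreconnected {x | F x ∈ U ∧ ℓ x = s}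

/-- Since `U` is simply connected, a unique section over `U` passes through each point above `U`.
Its value over the base point `F x₀` serves as the label. -/
theorem IsCoveringMapOn.exists_isSheetLabel {X Y : Type*} [TopologicalSpace X] [T2Space X]
    [TopologicalSpace Y] [LocallyPathConnectedSpace Y] {F : X → Y} (hF : IsLocalHomeomorph F)
    {U : Set Y} (hU : IsOpen U) [SimplyConnectedSpace U] (hcov : IsCoveringMapOn F U) {x₀ : X}
    (hx₀ : F x₀ ∈ U) : ∃ ℓ : X → F ⁻¹' {F x₀}, IsSheetLabel F U ℓ := by
  have : LocallyPathConnectedSpace U := hU.locallyPathConnectedSpace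
  have hex (x : X) (hx : F x ∈ U) : ∃ t : C(U, X), t ⟨F x, hx⟩ = x ∧ ∀ u, F (t u) = u := by
    obtain ⟨t, ⟨h1, h2⟩, -⟩ := hcov.existsUnique_continuousMap_lifts ⟨((↑) : U → Y), by fun_prop⟩
      (a₀ := ⟨F x, hx⟩) (e₀ := x) rfl (fun u ↦ u.2)
    exact ⟨t, h1, congr_fun h2⟩
  choose t ht hFt using hex
  have huniq (t t' : C(U, X)) (h : ∀ u, F (t u) = u) (h' : ∀ u, F (t' u) = u) (u : U)
      (hu : t u = t' u) : t = t' :=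
    DFunLike.coe_injective ((T2Space.isSeparatedMap F).eq_of_comp_eq hF.isLocallyInjective
      t.continuous t'.continuous (funext fun u ↦ (h u).trans (h' u).symm) u hu)
  let u₀ : U := ⟨F x₀, hx₀⟩
  classical
  -- Outside `F ⁻¹' U` the label is the arbitrary value `x₀`.
  let ℓ (x : X) : F ⁻¹' {F x₀} := if hx : F x ∈ U then ⟨t x hx u₀, hFt x hx u₀⟩ else ⟨x₀, rfl⟩
  have hℓ (x : X) (hx : F x ∈ U) : (ℓ x).1 = t x hx u₀ := by simp only [ℓ, dif_pos hx]
  have hℓt (x : X) (hx : F x ∈ U) (u : U) : ℓ (t x hx u) = ℓ x := by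
    have hu : F (t x hx u) ∈ U := by rw [hFt]; exact u.2
    apply Subtype.ext
    rw [hℓ _ hx, hℓ _ hu]
    congr 1
    refine huniq _ _ (hFt _ hu) (hFt _ hx) u ?_
    have h1 := ht (t x hx u) hu
    have h2 : (⟨F (t x hx u), hu⟩ : U) = u := Subtype.ext (hFt x hx u)
    rwa [h2] at h1
  have hSU (s : F ⁻¹' {F x₀}) : F s.1 ∈ U := by rw [show F s.1 = F x₀ from s.2]; exact hx₀
  have htu (s : F ⁻¹' {F x₀}) : t s.1 (hSU s) u₀ = s.1 := by
    have h1 := ht s.1 (hSU s)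
    rwa [show (⟨F s.1, hSU s⟩ : U) = u₀ from Subtype.ext s.2] at h1
  refine ⟨ℓ, fun x hx ↦ ?_, fun x x' hx hxx' h ↦ ?_, fun y hy s ↦ ?_, fun s ↦ ?_⟩
  -- For `x'` near `x`, both `x'` and the point of the section through `x` above `F x'` lie in `M`,
  -- where `F` is injective; so `x'` lies on that section.
  · obtain ⟨M, hMo, hxM, hM⟩ := hF.isLocallyInjective x
    have hc : ContinuousAt (fun x' ↦ if h : F x' ∈ U then t x hx ⟨F x', h⟩ else x') x := by
      have hc1 : ContinuousOn (fun x' ↦ if h : F x' ∈ U then t x hx ⟨F x', h⟩ else x')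
          (F ⁻¹' U) := by
        rw [continuousOn_iff_continuous_domRestrict]
        refine ((t x hx).continuous.comp (f := fun x' : F ⁻¹' U ↦ (⟨F x', x'.2⟩ : U))
          ((hF.continuous.comp continuous_subtype_val).subtype_mk _)).congr fun x' ↦ ?_
        simp [dif_pos (show F x' ∈ U from x'.2)]
      exact hc1.continuousAt ((hU.preimage hF.continuous).mem_nhds hx)
    have hM' := hc.preimage_mem_nhds (t := M) (by
      rw [dif_pos hx, ht]; exact hMo.mem_nhds hxM)
    filter_upwards [hM', hMo.mem_nhds hxM, (hU.preimage hF.continuous).mem_nhds hx] with x' h1 h2 h3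
    have h3' : F x' ∈ U := h3
    rw [mem_preimage, dif_pos h3'] at h1
    have h4 : t x hx ⟨F x', h3'⟩ = x' := hM h1 h2 (hFt _ _ _)
    rw [← hℓt x hx ⟨F x', h3'⟩, h4]
  · have hx' : F x' ∈ U := hxx' ▸ hx
    have h1 : t x hx = t x' hx' := huniq _ _ (hFt _ _) (hFt _ _) u₀ (by
      rw [← hℓ, ← hℓ, h])
    rw [← ht x hx, ← ht x' hx', h1]
    congr 1
    exact Subtype.ext hxx'
  · refine ⟨t s.1 (hSU s) ⟨y, hy⟩, hFt _ _ _, ?_⟩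
    rw [hℓt]
    exact Subtype.ext ((hℓ _ (hSU s)).trans (htu s))
  -- The sheet labelled `s` is the image of the connected set `U` under the section through `s`.
  · convert! isPreconnected_range (t s.1 (hSU s)).continuous using 1
    ext x
    constructor
    · rintro ⟨hx, rfl⟩
      refine ⟨⟨F x, hx⟩, ?_⟩
      rw [huniq (t (ℓ x).1 (hSU _)) (t x hx) (hFt _ _) (hFt _ _) u₀ ((htu _).trans (hℓ _ hx)), ht]
    · rintro ⟨u, rfl⟩
      refine ⟨by rw [hFt]; exact u.2, ?_⟩
      rw [hℓt]
      exact Subtype.ext ((hℓ _ (hSU s)).trans (htu s))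

/-! ### The crossing permutation -/

theorem IsTwoSidedBox.neg {E : Type*} [TopologicalSpace E] {A N : Set E} {h : E → ℝ}
    (hN : IsTwoSidedBox A N h) : IsTwoSidedBox A N (-h) where
  isOpen := hN.isOpen
  isPreconnected := hN.isPreconnected
  continuousOn := hN.continuousOn.neg
  mem_iff := by simpa using hN.mem_iff
  isPreconnected_pos := by simpa using hN.isPreconnected_neg
  isPreconnected_neg := by simpa using hN.isPreconnected_pos
  mem_closure_pos := by simpa using hN.mem_closure_neg
  mem_closure_neg := by simpa using hN.mem_closure_pos

/-- Crossing the set `B` in the two-sided box `N` from the side `0 < h` to the side `h < 0` permutes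
the sheets of `F` over the complement of `B` by `σ`. -/
structure IsCrossingBox {X Y S : Type*} [TopologicalSpace X] [TopologicalSpace Y] (F : X → Y)
    (ℓ : X → S) (B N : Set Y) (h : Y → ℝ) (σ : Equiv.Perm S) : Prop
    extends IsTwoSidedBox B N h where
  exists_isSectionOn : ∀ x, F x ∈ N → ∃ t, IsSectionOn F t N ∧ t (F x) = x
  crossing : ∀ t, IsSectionOn F t N → ∀ u ∈ N, ∀ v ∈ N, 0 < h u → h v < 0 → ℓ (t v) = σ (ℓ (t u))

section Crossing

variable {X Y S : Type*} [TopologicalSpace X] [TopologicalSpace Y] {F : X → Y}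
  {ℓ : X → S} {B N N' : Set Y} {h h' : Y → ℝ} {σ σ' : Equiv.Perm S}

theorem IsSheetLabel.eq_of_isSectionOn (hℓ : IsSheetLabel F Bᶜ ℓ) {t : Y → X} {C : Set Y}
    (ht : IsSectionOn F t C) (hC : IsPreconnected C) (hCB : C ⊆ Bᶜ) {u v : Y} (hu : u ∈ C)
    (hv : v ∈ C) : ℓ (t u) = ℓ (t v) :=
  hC.eq_of_eventually_eq (f := fun y ↦ ℓ (t y)) (fun y hy ↦ (ht.continuousOn y hy).eventually
    (hℓ.eventually_eq (t y) (by rw [ht.apply_eq y hy]; exact hCB hy))) hu hv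

theorem IsTwoSidedBox.pos_subset (hN : IsTwoSidedBox B N h) : {x ∈ N | 0 < h x} ⊆ Bᶜ :=
  fun x hx hxB ↦ hx.2.ne' ((hN.mem_iff x hx.1).1 hxB)

theorem IsTwoSidedBox.neg_subset (hN : IsTwoSidedBox B N h) : {x ∈ N | h x < 0} ⊆ Bᶜ :=
  fun x hx hxB ↦ hx.2.ne ((hN.mem_iff x hx.1).1 hxB)

/-- A section over `N` has one label on each side, and either label determines the section because
`N` is connected. Hence the label on the positive side determines the one on the negative side
bijectively. -/
theorem IsTwoSidedBox.exists_isCrossingBox [T2Space X] (hN : IsTwoSidedBox B N h)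
    (hF : IsLocalHomeomorph F) (hℓ : IsSheetLabel F Bᶜ ℓ) {a : Y} (haN : a ∈ N) (haB : a ∈ B)
    (hsec : ∀ x, F x ∈ N → ∃ t, IsSectionOn F t N ∧ t (F x) = x) :
    ∃ σ, IsCrossingBox F ℓ B N h σ := by
  have ha := (hN.mem_iff a haN).1 haB
  obtain ⟨u₀, hu₀⟩ := closure_nonempty_iff.1 ⟨a, hN.mem_closure_pos a haN ha⟩
  obtain ⟨v₀, hv₀⟩ := closure_nonempty_iff.1 ⟨a, hN.mem_closure_neg a haN ha⟩
  have hconst {t : Y → X} (ht : IsSectionOn F t N) {u v : Y} (hu : u ∈ {x ∈ N | 0 < h x})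
      (hv : v ∈ {x ∈ N | h x < 0}) : ℓ (t u) = ℓ (t u₀) ∧ ℓ (t v) = ℓ (t v₀) :=
    ⟨hℓ.eq_of_isSectionOn (ht.mono (sep_subset _ _)) hN.isPreconnected_pos hN.pos_subset hu hu₀,
      hℓ.eq_of_isSectionOn (ht.mono (sep_subset _ _)) hN.isPreconnected_neg hN.neg_subset hv hv₀⟩
  have hex (s : S) : ∃ t, IsSectionOn F t N ∧ ℓ (t u₀) = s := by
    obtain ⟨x, hx, rfl⟩ := hℓ.surj u₀ (hN.pos_subset hu₀) s
    obtain ⟨t, ht, htx⟩ := hsec x (by rw [hx]; exact hu₀.1)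
    exact ⟨t, ht, by rw [← hx, htx]⟩
  have huniq {t t' : Y → X} (ht : IsSectionOn F t N) (ht' : IsSectionOn F t' N) {w : Y}
      (hw : w ∈ N) (hwB : w ∈ Bᶜ) (hl : ℓ (t w) = ℓ (t' w)) : EqOn t t' N := by
    refine ht.eqOn hF ht' hN.isPreconnected hw (hℓ.inj _ _ ?_ ?_ hl)
    · rwa [ht.apply_eq w hw]
    · rw [ht.apply_eq w hw, ht'.apply_eq w hw]
  choose t ht hts using hex
  have hcross (t' : Y → X) (ht' : IsSectionOn F t' N) : ℓ (t' v₀) = ℓ (t (ℓ (t' u₀)) v₀) := by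
    rw [huniq ht' (ht (ℓ (t' u₀))) hu₀.1 (hN.pos_subset hu₀) (hts _).symm hv₀.1]
  have hbij : Function.Bijective fun s ↦ ℓ (t s v₀) := by
    constructor
    · intro s s' hss'
      rw [← hts s, ← hts s', huniq (ht s) (ht s') hv₀.1 (hN.neg_subset hv₀) hss' hu₀.1]
    · intro s
      obtain ⟨x, hx, rfl⟩ := hℓ.surj v₀ (hN.neg_subset hv₀) s
      obtain ⟨t', ht', htx⟩ := hsec x (by rw [hx]; exact hv₀.1)
      refine ⟨ℓ (t' u₀), ?_⟩
      dsimp only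
      rw [← hcross t' ht', ← hx, htx]
  refine ⟨.ofBijective _ hbij, { hN with exists_isSectionOn := hsec, crossing := ?_ }⟩
  intro t' ht' u hu v hv hhu hhv
  obtain ⟨h1, h2⟩ := hconst ht' ⟨hu, hhu⟩ ⟨hv, hhv⟩
  rw [h1, h2]
  exact hcross t' ht'

theorem IsCrossingBox.neg (hN : IsCrossingBox F ℓ B N h σ) : IsCrossingBox F ℓ B N (-h) σ⁻¹ where
  toIsTwoSidedBox := hN.toIsTwoSidedBox.neg
  exists_isSectionOn := hN.exists_isSectionOn
  crossing t ht u hu v hv hhu hhv := by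
    rw [Equiv.Perm.eq_inv_iff_eq]
    exact (hN.crossing t ht v hv u hu (by simpa using hhv) (by simpa using hhu)).symm

/-- On each side of `N'`, which is connected, `h` has no zero and so keeps its sign. The
permutations agree because sections over `N` restrict to `N'`. -/
theorem IsCrossingBox.pos_iff_of_subset (hN : IsCrossingBox F ℓ B N h σ)
    (hN' : IsCrossingBox F ℓ B N' h' σ') (hℓ : IsSheetLabel F Bᶜ ℓ) (hsub : N' ⊆ N) {a : Y}
    (haN : a ∈ N') (haB : a ∈ B) {u : Y} (hu : u ∈ N') (hu' : 0 < h' u) (hu'' : 0 < h u) :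
    (∀ y ∈ N', (0 < h' y → 0 < h y) ∧ (h' y < 0 → h y < 0)) ∧ σ' = σ := by
  have hc := hN.continuousOn.mono hsub
  have hne (y : Y) (hy : y ∈ N') (h0 : h' y ≠ 0) : h y ≠ 0 := by
    rwa [Ne, ← hN.mem_iff y (hsub hy), hN'.mem_iff y hy]
  have hpos (y : Y) (hy : y ∈ N') (hy' : 0 < h' y) : 0 < h y := by
    by_contra hlt
    obtain ⟨z, hz, hz0⟩ := hN'.isPreconnected_pos.intermediate_value (f := h) ⟨hy, hy'⟩ ⟨hu, hu'⟩
      (hc.mono (sep_subset _ _)) ⟨not_lt.1 hlt, hu''.le⟩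
    exact hne z hz.1 hz.2.ne' hz0
  -- Adherence of the negative side of `N` to `a` excludes that both sides of `N'` lie where `h` is
  -- positive.
  obtain ⟨v, hv, hvh⟩ : ∃ v ∈ N', h v < 0 := by
    have h1 := hN.mem_closure_neg a (hsub haN) ((hN.mem_iff a (hsub haN)).1 haB)
    obtain ⟨v, hvN', hv⟩ := mem_closure_iff.1 h1 N' hN'.isOpen haN
    exact ⟨v, hvN', hv.2⟩
  have hvh' : h' v < 0 := by
    refine lt_of_le_of_ne (not_lt.1 fun h0 ↦ (hpos v hv h0).not_gt hvh) fun h0 ↦ ?_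
    rw [← hN'.mem_iff v hv, hN.mem_iff v (hsub hv)] at h0
    exact hvh.ne h0
  have hneg (y : Y) (hy : y ∈ N') (hy' : h' y < 0) : h y < 0 := by
    by_contra hlt
    obtain ⟨z, hz, hz0⟩ := hN'.isPreconnected_neg.intermediate_value (f := h) ⟨hv, hvh'⟩ ⟨hy, hy'⟩
      (hc.mono (sep_subset _ _)) ⟨hvh.le, not_lt.1 hlt⟩
    exact hne z hz.1 hz.2.ne hz0
  refine ⟨fun y hy ↦ ⟨hpos y hy, hneg y hy⟩, Equiv.ext fun s ↦ ?_⟩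
  obtain ⟨x, hx, rfl⟩ := hℓ.surj u (hN'.pos_subset ⟨hu, hu'⟩) s
  obtain ⟨t, ht, htx⟩ := hN.exists_isSectionOn x (by rw [hx]; exact hsub hu)
  rw [← htx, hx, ← hN'.crossing t (ht.mono hsub) u hu v hv hu' hvh',
    ← hN.crossing t ht u (hsub hu) v (hsub hv) hu'' hvh]

/-- A crossing box inside another one carries the same permutation and the same sides, or the
inverse permutation and the opposite sides. -/
theorem IsCrossingBox.compare_of_subset (hN : IsCrossingBox F ℓ B N h σ)
    (hN' : IsCrossingBox F ℓ B N' h' σ') (hℓ : IsSheetLabel F Bᶜ ℓ) (hsub : N' ⊆ N) {a : Y}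
    (haN : a ∈ N') (haB : a ∈ B) :
    ((∀ y ∈ N', (0 < h' y → 0 < h y) ∧ (h' y < 0 → h y < 0)) ∧ σ' = σ) ∨
      ((∀ y ∈ N', (0 < h' y → h y < 0) ∧ (h' y < 0 → 0 < h y)) ∧ σ' = σ⁻¹) := by
  obtain ⟨u, hu, hu'⟩ := closure_nonempty_iff.1
    ⟨a, hN'.mem_closure_pos a haN ((hN'.mem_iff a haN).1 haB)⟩
  have hne : h u ≠ 0 := by
    rw [Ne, ← hN.mem_iff u (hsub hu), hN'.mem_iff u hu]
    exact hu'.ne'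
  obtain hlt | hlt := hne.lt_or_gt
  · right
    simpa using hN.neg.pos_iff_of_subset hN' hℓ hsub haN haB hu hu' (by simpa using hlt)
  · exact .inl (hN.pos_iff_of_subset hN' hℓ hsub haN haB hu hu' hlt)

/-- Each point of `A` has arbitrarily small crossing boxes. -/
def HasCrossingBoxes {X Y S : Type*} [TopologicalSpace X] [TopologicalSpace Y] (F : X → Y)
    (ℓ : X → S) (B A : Set Y) : Prop :=
  ∀ a ∈ A, ∀ W ∈ 𝓝 a, ∃ N ⊆ W, a ∈ N ∧ ∃ h σ, IsCrossingBox F ℓ B N h σ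

theorem IsCrossingBox.eq_or_eq_inv (hN : IsCrossingBox F ℓ B N h σ)
    (hN' : IsCrossingBox F ℓ B N' h' σ') (hℓ : IsSheetLabel F Bᶜ ℓ) {A : Set Y} (hAB : A ⊆ B)
    (hA : HasCrossingBoxes F ℓ B A) {a : Y} (haA : a ∈ A) (haN : a ∈ N) (haN' : a ∈ N') :
    σ' = σ ∨ σ' = σ⁻¹ := by
  obtain ⟨N'', hsub, ha, h'', σ'', hN''⟩ := hA a haA (N ∩ N')
    (inter_mem (hN.isOpen.mem_nhds haN) (hN'.isOpen.mem_nhds haN'))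
  have h1 := hN.compare_of_subset hN'' hℓ (hsub.trans inter_subset_left) ha (hAB haA)
  have h2 := hN'.compare_of_subset hN'' hℓ (hsub.trans inter_subset_right) ha (hAB haA)
  obtain ⟨-, rfl⟩ | ⟨-, rfl⟩ := h1 <;> obtain ⟨-, h2⟩ | ⟨-, h2⟩ := h2
  · exact .inl h2.symm
  · exact .inr (by rw [h2, inv_inv])
  · exact .inr h2.symm
  · exact .inl (inv_injective h2.symm)

/-- Along a connected set, the crossing permutation is unique up to inversion. -/
theorem HasCrossingBoxes.exists_perm (hℓ : IsSheetLabel F Bᶜ ℓ) {A : Set Y} (hAB : A ⊆ B)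
    (hA : HasCrossingBoxes F ℓ B A) (hAc : IsConnected A) :
    ∃ σ₀ : Equiv.Perm S, ∀ N h σ, IsCrossingBox F ℓ B N h σ → (N ∩ A).Nonempty →
      σ = σ₀ ∨ σ = σ₀⁻¹ := by
  -- The set of all crossing permutations at `a` is `{σ, σ⁻¹}` for any one of them, hence locally
  -- constant along `A`.
  let f (a : Y) : Set (Equiv.Perm S) := {τ | ∃ N h, a ∈ N ∧ IsCrossingBox F ℓ B N h τ}
  have hf {N h σ} (hN : IsCrossingBox F ℓ B N h σ) {a : Y} (ha : a ∈ A) (haN : a ∈ N) :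
      f a = {σ, σ⁻¹} := by
    ext τ
    constructor
    · rintro ⟨N', h', haN', hN'⟩
      exact hN.eq_or_eq_inv hN' hℓ hAB hA ha haN haN'
    · rintro (rfl | rfl)
      exacts [⟨N, h, haN, hN⟩, ⟨N, _, haN, hN.neg⟩]
  have hconst {a b : Y} (ha : a ∈ A) (hb : b ∈ A) : f a = f b := by
    refine hAc.isPreconnected.eq_of_eventually_eq (fun y hy ↦ ?_) ha hb
    obtain ⟨N, -, hyN, h, σ, hN⟩ := hA y hy univ univ_mem
    filter_upwards [self_mem_nhdsWithin, mem_nhdsWithin_of_mem_nhds (hN.isOpen.mem_nhds hyN)]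
      with z hz hzN
    rw [hf hN hz hzN, hf hN hy hyN]
  obtain ⟨a, ha⟩ := hAc.nonempty
  obtain ⟨N₀, -, haN₀, h₀, σ₀, hN₀⟩ := hA a ha univ univ_mem
  refine ⟨σ₀, fun N h σ hN ⟨b, hbN, hb⟩ ↦ ?_⟩
  have : σ ∈ f b := ⟨N, h, hbN, hN⟩
  rwa [← hconst ha hb, hf hN₀ ha haN₀] at this

end Crossing

/-! ### Transitivity on the sheets -/

section Transitivity

variable {X Y S : Type*} [TopologicalSpace X] [TopologicalSpace Y] {F : X → Y}
  {ℓ : X → S} {B : Set Y}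

/-- A label which is constant along a local section near a point of `B` is locally constant. -/
theorem IsSheetLabel.exists_eventually_eq_of_isPreconnected (hF : IsLocalHomeomorph F)
    (hℓ : IsSheetLabel F Bᶜ ℓ) {x : X}
    (hx : ∀ W ∈ 𝓝 (F x), ∃ V ⊆ W, IsOpen V ∧ F x ∈ V ∧ IsPreconnected (V \ B)) :
    ∃ s, ∀ᶠ x' in 𝓝 x, F x' ∈ Bᶜ → ℓ x' = s := by
  obtain ⟨W, hWo, hxW, t, ht, -, hev⟩ := hF.exists_isSectionOn x
  obtain ⟨V, hVW, hVo, hxV, hV⟩ := hx W (hWo.mem_nhds hxW)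
  obtain hem | ⟨u, hu⟩ := (V \ B).eq_empty_or_nonempty
  · refine ⟨ℓ x, ?_⟩
    filter_upwards [hF.continuous.continuousAt.eventually (hVo.mem_nhds hxV)] with x' hx' hB
    exact (eq_empty_iff_forall_notMem.1 hem _ ⟨hx', hB⟩).elim
  · refine ⟨ℓ (t u), ?_⟩
    filter_upwards [hev, hF.continuous.continuousAt.eventually (hVo.mem_nhds hxV)] with x' h1 h2 hB
    rw [← h1]
    exact hℓ.eq_of_isSectionOn (ht.mono (sdiff_subset.trans hVW)) hV (fun y hy ↦ hy.2) ⟨h2, hB⟩ hu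

/-- The labels of a section on the two sides differ by `σ`, so a `σ`-invariant set contains both or
neither. -/
theorem IsCrossingBox.eventually_mem {N : Set Y} {h : Y → ℝ} {σ : Equiv.Perm S}
    (hN : IsCrossingBox F ℓ B N h σ) (hℓ : IsSheetLabel F Bᶜ ℓ) {V : Set Y} (hNV : N ⊆ V)
    {t : Y → X} (ht : IsSectionOn F t V) {u : Y} (huN : u ∈ N) (hu : 0 < h u) {O : Set S}
    (hO : ∀ s, σ s ∈ O ↔ s ∈ O) (hut : ℓ (t u) ∈ O) : ∀ y ∈ N, y ∈ Bᶜ → ℓ (t y) ∈ O := by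
  intro y hyN hyB
  rw [mem_compl_iff, hN.mem_iff y hyN] at hyB
  obtain hlt | hlt := lt_or_gt_of_ne hyB
  · rw [hN.crossing t (ht.mono hNV) u huN y hyN hu hlt, hO]
    exact hut
  · rwa [hℓ.eq_of_isSectionOn (ht.mono ((sep_subset _ _).trans hNV)) hN.isPreconnected_pos
      hN.pos_subset ⟨hyN, hlt⟩ ⟨huN, hu⟩]

/-- The crossing permutation acts transitively on the sheets. -/
theorem IsSheetLabel.eq_empty_or_eq_univ [ConnectedSpace X] (hF : IsLocalHomeomorph F)
    (hℓ : IsSheetLabel F Bᶜ ℓ) (hB : Dense Bᶜ) {A D₀ Z : Set Y}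
    (hBADZ : B ⊆ A ∪ D₀ ∪ Z) (hZB : Z ⊆ B) (hA : HasCrossingBoxes F ℓ B A)
    (hD₀ : ∀ p ∈ D₀, ∀ W ∈ 𝓝 p, ∃ V ⊆ W, IsOpen V ∧ p ∈ V ∧ IsPreconnected (V \ B))
    (hZ : ∀ p ∈ Z, ∀ W ∈ 𝓝 p, ∃ V ⊆ W, IsOpen V ∧ p ∈ V ∧ IsPreconnected (V \ Z))
    {σ₀ : Equiv.Perm S} (hσ₀ : ∀ N h σ, IsCrossingBox F ℓ B N h σ → (N ∩ A).Nonempty →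
      σ = σ₀ ∨ σ = σ₀⁻¹) (O : Set S) (hO : ∀ s, σ₀ s ∈ O ↔ s ∈ O) : O = ∅ ∨ O = univ := by
  -- The points near which only labels in `O` occur. `Q O` and `Q Oᶜ` are open, disjoint by density,
  -- and shown to cover the connected space `X`.
  let Q (O : Set S) : Set X := {x | ∀ᶠ x' in 𝓝 x, F x' ∈ Bᶜ → ℓ x' ∈ O}
  have hQo (O : Set S) : IsOpen (Q O) := isOpen_setOfPred_eventually_nhds
  have hdense : Dense (F ⁻¹' Bᶜ) := hB.preimage hF.isOpenMap
  have hQd : Q O ∩ Q Oᶜ = ∅ := by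
    refine eq_empty_of_forall_notMem fun x ⟨h1, h2⟩ ↦ ?_
    obtain ⟨x', h3, h1, h2⟩ := hdense.inter_nhds_nonempty (h1.and h2)
    exact h2 h3 (h1 h3)
  have hmem (s : S) : s ∈ O ∨ s ∈ Oᶜ := em _
  have hQU (x : X) (hx : F x ∉ Z) : x ∈ Q O ∪ Q Oᶜ := by
    by_cases hxB : F x ∈ B
    · obtain (hxA | hxD) | hxZ := hBADZ hxB
      · obtain ⟨V, hVo, hxV, t, ht, -, hev⟩ := hF.exists_isSectionOn x
        obtain ⟨N, hNV, hxN, h, σ, hN⟩ := hA _ hxA V (hVo.mem_nhds hxV)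
        obtain ⟨u, huN, hu⟩ := closure_nonempty_iff.1
          ⟨F x, hN.mem_closure_pos _ hxN ((hN.mem_iff _ hxN).1 hxB)⟩
        have hσ (s : S) : σ s ∈ O ↔ s ∈ O := by
          obtain rfl | rfl := hσ₀ N h σ hN ⟨F x, hxN, hxA⟩
          · exact hO s
          · simpa using (hO (σ₀⁻¹ s)).symm
        have hnear := hF.continuous.continuousAt.eventually (hN.isOpen.mem_nhds hxN)
        refine (hmem (ℓ (t u))).imp (fun h ↦ ?_) (fun h ↦ ?_)
        · filter_upwards [hev, hnear] with x' h1 h2 h3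
          rw [← h1]
          exact hN.eventually_mem hℓ hNV ht huN hu hσ h _ h2 h3
        · filter_upwards [hev, hnear] with x' h1 h2 h3
          rw [← h1]
          exact hN.eventually_mem hℓ hNV ht huN hu (fun s ↦ not_congr (hσ s)) h _ h2 h3
      · obtain ⟨s, hs⟩ := hℓ.exists_eventually_eq_of_isPreconnected hF (hD₀ _ hxD)
        refine (hmem s).imp (fun h ↦ ?_) (fun h ↦ ?_)
        · filter_upwards [hs] with x' h1 h2 using by rwa [h1 h2]
        · filter_upwards [hs] with x' h1 h2 using by rwa [h1 h2]
      · exact absurd hxZ hx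
    · refine (hmem (ℓ x)).imp (fun h ↦ ?_) (fun h ↦ ?_)
      · filter_upwards [hℓ.eventually_eq x hxB] with x' h1 _ using by rwa [h1]
      · filter_upwards [hℓ.eventually_eq x hxB] with x' h1 _ using by rwa [h1]
  have hcover (x : X) : x ∈ Q O ∪ Q Oᶜ := by
    by_cases hxZ : F x ∈ Z
    · obtain ⟨W, hWo, hxW, t, ht, -, hev⟩ := hF.exists_isSectionOn x
      obtain ⟨V, hVW, hVo, hxV, hV⟩ := hZ _ hxZ W (hWo.mem_nhds hxW)
      have hnear := hF.continuous.continuousAt.eventually (hVo.mem_nhds hxV)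
      -- Over `Z`, the connected set `t '' (V \ Z)` is already covered by the two disjoint open
      -- sets, so it lies in one of them.
      have hsub : t '' (V \ Z) ⊆ Q O ∪ Q Oᶜ := by
        rintro - ⟨y, hy, rfl⟩
        exact hQU _ (by rw [ht.apply_eq y (hVW hy.1)]; exact hy.2)
      have hpre := hV.image t (ht.continuousOn.mono (sdiff_subset.trans hVW))
      have hfin (O : Set S) (h : t '' (V \ Z) ⊆ Q O) : x ∈ Q O := by
        filter_upwards [hev, hnear] with x' h1 h2 h3
        rw [← h1]
        exact (h ⟨F x', ⟨h2, fun hz ↦ h3 (hZB hz)⟩, rfl⟩ : t (F x') ∈ Q O).self_of_nhds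
          (by rwa [h1])
      exact (isPreconnected_iff_subset_of_disjoint.1 hpre _ _ (hQo _) (hQo _) hsub
        (by rw [hQd, inter_empty])).imp (hfin O) (hfin Oᶜ)
    · exact hQU x hxZ
  obtain ⟨y, hy⟩ : (Bᶜ : Set Y).Nonempty := by
    obtain ⟨x⟩ : Nonempty X := inferInstance
    exact hB.nonempty_iff.2 ⟨F x⟩
  have hfin (O : Set S) (h : univ ⊆ Q O) : O = univ := by
    refine eq_univ_of_forall fun s ↦ ?_
    obtain ⟨x, rfl, rfl⟩ := hℓ.surj y hy s
    exact (h (mem_univ x) : ∀ᶠ x' in 𝓝 x, _).self_of_nhds hy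
  obtain h | h := isPreconnected_iff_subset_of_disjoint.1 isPreconnected_univ _ _ (hQo O) (hQo Oᶜ)
    (fun x _ ↦ hcover x) (by rw [hQd, inter_empty])
  · exact .inr (hfin O h)
  · exact .inl (compl_univ_iff.1 (hfin Oᶜ h))

end Transitivity

/-! ### The height function -/

/-- If crossing is asymmetric, then `H₁(X, ℤ) = 0` yields an integer valued function of the sheets
which increases by one at each crossing. -/
theorem IsSheetLabel.exists_height {X : Type u} {Y S : Type*} [TopologicalSpace X]
    [TopologicalSpace Y] [ConnectedSpace X] [LocallyPathConnectedSpace X] (hX : VanishingH1 X)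
    {F : X → Y} (hF : IsLocalHomeomorph F) {ℓ : X → S} {B A : Set Y} (hBc : IsClosed B)
    (hℓ : IsSheetLabel F Bᶜ ℓ) (hB : Dense Bᶜ) (hAB : A ⊆ B) (hFA : ∀ x, F x ∈ B → F x ∈ A)
    (hA : HasCrossingBoxes F ℓ B A) (hAn : A.Nonempty) {σ₀ : Equiv.Perm S}
    (hσ₀ : ∀ N h σ, IsCrossingBox F ℓ B N h σ → (N ∩ A).Nonempty → σ = σ₀ ∨ σ = σ₀⁻¹)
    (hne : σ₀ ≠ σ₀⁻¹) : ∃ γ : S → ℤ, ∀ s, γ (σ₀ s) = γ s + 1 := by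
  classical
  have hbox (a : A) : ∃ N, a.1 ∈ N ∧ ∃ h, IsCrossingBox F ℓ B N h σ₀ := by
    obtain ⟨N, -, haN, h, σ, hN⟩ := hA a a.2 univ univ_mem
    obtain rfl | rfl := hσ₀ N h σ hN ⟨a, haN, a.2⟩
    · exact ⟨N, haN, h, hN⟩
    · exact ⟨N, haN, -h, by simpa using hN.neg⟩
  choose N haN h hN using hbox
  -- The cover consists of the complement of `B` and of boxes oriented so that crossing them is
  -- `σ₀`. On a box, `g` is the indicator of the positive side; the differences `g j - g i` will
  -- extend across `B` to a locally constant cocycle, although `g` itself jumps there.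
  let M : Option A → Set Y := fun i ↦ i.elim Bᶜ N
  let g : Option A → Y → ℤ := fun i ↦ i.elim 0 fun a y ↦ if 0 < h a y then 1 else 0
  have hM (i) : IsOpen (M i) := by
    cases i with
    | none => exact hBc.isOpen_compl
    | some a => exact (hN a).isOpen
  have hg (i) (y) (hy : y ∈ M i) (hyB : y ∈ Bᶜ) : ∀ᶠ y' in 𝓝 y, g i y' = g i y := by
    cases i with
    | none => exact .of_forall fun _ ↦ rfl
    | some a =>
      have hc : ContinuousAt (h a) y := (hN a).continuousOn.continuousAt ((hN a).isOpen.mem_nhds hy)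
      rw [mem_compl_iff, (hN a).mem_iff y hy] at hyB
      obtain hlt | hlt := lt_or_gt_of_ne hyB
      · filter_upwards [hc.eventually_lt continuousAt_const hlt] with y' hy'
        simp [g, hy'.not_gt, hlt.not_gt]
      · filter_upwards [continuousAt_const.eventually_lt hc hlt] with y' hy'
        simp [g, hy', hlt]
  have hjump (i j) (x : X) (hi : F x ∈ M i) (hj : F x ∈ M j) :
      ∃ k : ℤ, ∀ᶠ y in 𝓝 (F x), y ∈ Bᶜ → g j y - g i y = k := by
    by_cases hxB : F x ∈ B
    · cases i with
      | none => exact absurd hxB hi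
      | some a =>
        cases j with
        | none => exact absurd hxB hj
        | some b =>
          -- Two boxes with opposite positive sides would give `σ₀ = σ₀⁻¹`, so the indicators agree
          -- near `F x` off `B`.
          refine ⟨0, ?_⟩
          obtain ⟨N', hsub, hxN', h', σ', hN'⟩ := hA _ (hFA x hxB) _
            (inter_mem ((hN a).isOpen.mem_nhds hi) ((hN b).isOpen.mem_nhds hj))
          have h1 := (hN a).compare_of_subset hN' hℓ (hsub.trans inter_subset_left) hxN' hxB
          have h2 := (hN b).compare_of_subset hN' hℓ (hsub.trans inter_subset_right) hxN' hxB
          filter_upwards [hN'.isOpen.mem_nhds hxN'] with y hy hyB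
          rw [mem_compl_iff, hN'.mem_iff y hy] at hyB
          simp only [g, Option.elim]
          obtain ⟨h1, rfl⟩ | ⟨h1, rfl⟩ := h1 <;> obtain ⟨h2, h3⟩ | ⟨h2, h3⟩ := h2
          · obtain hlt | hlt := lt_or_gt_of_ne hyB
            · simp [((h1 y hy).2 hlt).not_gt, ((h2 y hy).2 hlt).not_gt]
            · simp [(h1 y hy).1 hlt, (h2 y hy).1 hlt]
          · exact absurd h3 hne
          · exact absurd h3.symm hne
          · obtain hlt | hlt := lt_or_gt_of_ne hyB
            · simp [(h1 y hy).2 hlt, (h2 y hy).2 hlt]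
            · simp [((h1 y hy).1 hlt).not_gt, ((h2 y hy).1 hlt).not_gt]
    · refine ⟨g j (F x) - g i (F x), ?_⟩
      filter_upwards [hg i _ hi hxB, hg j _ hj hxB] with y h1 h2 _
      rw [h1, h2]
  have huniq {y : Y} {u : Y → ℤ} {k k' : ℤ} (hk : ∀ᶠ y in 𝓝 y, y ∈ Bᶜ → u y = k)
      (hk' : ∀ᶠ y in 𝓝 y, y ∈ Bᶜ → u y = k') : k = k' := by
    obtain ⟨z, hz, h1, h2⟩ := hB.inter_nhds_nonempty (hk.and hk')
    rw [← h1 hz, h2 hz]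
  choose! c hcj using hjump
  have hFc := hF.continuous
  obtain ⟨G, hG, hGc⟩ := hX.exists_coboundary (fun i ↦ F ⁻¹' M i) (fun i ↦ (hM i).preimage hFc)
    (fun x ↦ by
      by_cases hxB : F x ∈ B
      exacts [⟨some ⟨F x, hFA x hxB⟩, haN _⟩, ⟨none, hxB⟩]) c
    (fun i j x hx ↦ by
      filter_upwards [hFc.continuousAt.eventually (eventually_eventually_nhds.2
        (hcj i j x hx.1 hx.2)), ((hM i).preimage hFc).mem_nhds hx.1,
        ((hM j).preimage hFc).mem_nhds hx.2] with x' h1 h2 h3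
      exact huniq (hcj i j x' h2 h3) h1)
    (fun i j k x hx ↦ by
      refine huniq (u := fun y ↦ g k y - g i y) ?_ (hcj i k x hx.1.1 hx.2)
      filter_upwards [hcj i j x hx.1.1 hx.1.2, hcj j k x hx.1.2 hx.2] with y h1 h2 hy
      rw [← h1 hy, ← h2 hy]
      ring)
  have hcU (i j) (x) (hi : F x ∈ M i) (hj : F x ∈ M j) (hx : F x ∈ Bᶜ) :
      c i j x = g j (F x) - g i (F x) :=
    ((hcj i j x hi hj).self_of_nhds hx).symm
  obtain ⟨a, ha⟩ := hAn
  obtain ⟨y₀, hy₀⟩ : (Bᶜ : Set Y).Nonempty := hB.nonempty_iff.2 ⟨a⟩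
  choose x₀ hx₀ hℓx₀ using hℓ.surj y₀ hy₀
  -- The primitive is locally constant on each connected sheet, hence a function of the label.
  have hγ (x : X) (hx : F x ∈ Bᶜ) : G none x = G none (x₀ (ℓ x)) := by
    refine (hℓ.isPreconnected (ℓ x)).eq_of_eventually_eq (fun x' hx' ↦ ?_) ⟨hx, rfl⟩
      ⟨by rwa [hx₀], hℓx₀ _⟩
    exact (hG none x' hx'.1).filter_mono nhdsWithin_le_nhds
  refine ⟨fun s ↦ G none (x₀ s), fun s ↦ ?_⟩
  have hb := hN ⟨a, ha⟩
  have ha0 := (hb.mem_iff a (haN _)).1 (hAB ha)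
  obtain ⟨u, huN, hu⟩ := closure_nonempty_iff.1 ⟨a, hb.mem_closure_pos a (haN _) ha0⟩
  obtain ⟨v, hvN, hv⟩ := closure_nonempty_iff.1 ⟨a, hb.mem_closure_neg a (haN _) ha0⟩
  have huB := hb.pos_subset ⟨huN, hu⟩
  have hvB := hb.neg_subset ⟨hvN, hv⟩
  obtain ⟨x, rfl, rfl⟩ := hℓ.surj u huB s
  obtain ⟨t, ht, htx⟩ := hb.exists_isSectionOn x huN
  have hcr := hb.crossing t ht (F x) huN v hvN hu hv
  have hFv := ht.apply_eq v hvN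
  rw [htx] at hcr
  dsimp only
  -- The primitive of the box is constant along the section `t`, so passing to the negative side
  -- raises `G none` by exactly the jump of the indicator.
  have hstep (z : X) (hz : F z ∈ N ⟨a, ha⟩) (hzB : F z ∈ Bᶜ) :
      G none z = G (some ⟨a, ha⟩) z - if 0 < h ⟨a, ha⟩ (F z) then 1 else 0 := by
    rw [hGc (some ⟨a, ha⟩) none z ⟨hz, hzB⟩, hcU (some ⟨a, ha⟩) none z hz hzB hzB]
    exact congr_arg _ (zero_sub _)
  have hGa : G (some ⟨a, ha⟩) (t v) = G (some ⟨a, ha⟩) (t (F x)) := by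
    refine hb.isPreconnected.eq_of_eventually_eq (f := fun y ↦ G (some ⟨a, ha⟩) (t y))
      (fun y hy ↦ ?_) hvN huN
    exact (ht.continuousOn y hy).eventually (hG _ _ (by
      rw [mem_preimage, ht.apply_eq y hy]; exact hy))
  rw [← hcr, ← hγ x huB, ← hγ (t v) (by rwa [hFv]), hstep x huN huB,
    hstep (t v) (by rwa [hFv]) (by rwa [hFv]), hFv, hGa, htx]
  simp [hu, hv.not_gt]

/-! ### Counting sheets and conclusion -/

/-- Sections of constant fibre coordinate in a trivialisation. A single `V` serves all points above
it, which a mere local homeomorphism does not provide. -/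
theorem IsCoveringMapOn.exists_isSectionOn {X Y : Type*} [TopologicalSpace X] [TopologicalSpace Y]
    {F : X → Y} {s : Set Y} (hF : IsCoveringMapOn F s) {y : Y} (hy : y ∈ s) :
    ∃ V, IsOpen V ∧ y ∈ V ∧ ∀ x, F x ∈ V → ∃ t, IsSectionOn F t V ∧ t (F x) = x := by
  obtain ⟨-, V, hyV, hVo, -, H, hH⟩ := hF y hy
  refine ⟨V, hVo, hyV, fun x hx ↦ ?_⟩
  classical
  let t (y : Y) : X := if hy : y ∈ V then H.symm (⟨y, hy⟩, (H ⟨x, hx⟩).2) else x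
  refine ⟨t, ⟨?_, fun y hy ↦ ?_⟩, ?_⟩
  · rw [continuousOn_iff_continuous_domRestrict]
    refine (continuous_subtype_val.comp (H.symm.continuous.comp
      (continuous_id.prodMk continuous_const))).congr
      (f := fun y : V ↦ (H.symm (y, (H ⟨x, hx⟩).2) : X)) fun y ↦ ?_
    simp [t]
  · simp only [t, dif_pos hy]
    rw [← hH, H.apply_symm_apply]
  · have h1 : H ⟨x, hx⟩ = (⟨F x, hx⟩, (H ⟨x, hx⟩).2) := Prod.ext (Subtype.ext (hH _)) rfl
    simp only [t, dif_pos hx]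
    rw [← h1, H.symm_apply_apply]

/-- A set with a transitive involution has at most two elements. -/
theorem Set.encard_le_two_of_transitive_of_eq_inv {X : Type*} {T : Set X} {σ : Equiv.Perm T}
    (htrans : ∀ O : Set T, (∀ s, σ s ∈ O ↔ s ∈ O) → O = ∅ ∨ O = univ) (hσ : σ = σ⁻¹)
    (s : T) : T.encard ≤ 2 := by
  have hinv (r : T) : σ (σ r) = r := by
    conv_lhs => enter [1]; rw [hσ]
    exact σ.symm_apply_apply r
  obtain h | h := htrans {s, σ s} fun r ↦ by
    simp only [mem_insert_iff, mem_singleton_iff, EmbeddingLike.apply_eq_iff_eq]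
    constructor
    · rintro (h | rfl)
      · exact .inr (by rw [← h, hinv])
      · exact .inl rfl
    · rintro (rfl | rfl)
      · exact .inr rfl
      · exact .inl (hinv s)
  · exact absurd h (insert_nonempty _ _).ne_empty
  · rw [← ENat.card_coe_set_eq, ← encard_univ, ← h]
    exact (encard_insert_le _ _).trans (by rw [encard_singleton, one_add_one_eq_two])

/-- A set with a transitive permutation that has a fixed point is a singleton. -/
theorem Set.encard_eq_one_of_transitive_of_fixed {X : Type*} {T : Set X} {σ : Equiv.Perm T}
    (htrans : ∀ O : Set T, (∀ s, σ s ∈ O ↔ s ∈ O) → O = ∅ ∨ O = univ) {s : T} (hs : σ s = s) :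
    T.encard = 1 := by
  obtain h | h := htrans {s} fun r ↦ by
    rw [mem_singleton_iff, mem_singleton_iff]
    conv_lhs => rw [← hs, EmbeddingLike.apply_eq_iff_eq]
  · exact absurd h (singleton_nonempty _).ne_empty
  · rw [← ENat.card_coe_set_eq, ← encard_univ, ← h, encard_singleton]

theorem mainTheorem4 {n : ℕ} {X : Type u} [TopologicalSpace X] [T2Space X]
    [SecondCountableTopology X] [ConnectedSpace X]
    [ChartedSpace (EuclideanSpace ℝ (Fin n)) X] [IsManifold (𝓡 n) ∞ X]
    (hX : VanishingH1 X)
    (F : X → EuclideanSpace ℝ (Fin n)) (hF : IsLocalDiffeomorph (𝓡 n) (𝓡 n) ∞ F)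
    (D : Set (EuclideanSpace ℝ (Fin n))) (hD : IsClosed D)
    (d : ℕ∞) (hcover : IsSheetedCoverAwayFrom F D d)
    (A : Set (EuclideanSpace ℝ (Fin n))) (hA : IsSubmanifold ((n : ℤ) - 1) A)
    (hAconn : IsConnected A) (hAD : NicelyBounds A D)
    (hsc : SimplyConnectedSpace ((closure A)ᶜ : Set (EuclideanSpace ℝ (Fin n)))) :
    d = 1 ∨ d = 2 ∨ d = ⊤ := by
  have hFl := hF.isLocalHomeomorph
  have : LocallyPathConnectedSpace X :=
    ChartedSpace.locallyPathConnectedSpace (EuclideanSpace ℝ (Fin n)) X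
  set B := closure A with hBdef
  have hAB : A ⊆ B := subset_closure
  have hDB : D = B \ A := hAD.eq_boundary
  have hBU : IsOpen Bᶜ := isClosed_closure.isOpen_compl
  have hBD : Bᶜ ⊆ Dᶜ := compl_subset_compl.2 (hDB ▸ sdiff_subset)
  have hAD' : A ⊆ Dᶜ := fun a ha haD ↦ (hDB ▸ haD : a ∈ B \ A).2 ha
  have hcov : IsCoveringMapOn F Dᶜ := .of_isCoveringMap_restrictPreimage _ hD.isOpen_compl
    (hD.isOpen_compl.preimage hFl.continuous) hcover.1
  -- Away from `D` the sets `A` and `B` coincide, so a small box for `A` is one for `B`.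
  have hbox {a} (ha : a ∈ A) {W} (hW : W ∈ 𝓝 a) : ∃ N ⊆ W, a ∈ N ∧ ∃ h, IsTwoSidedBox B N h := by
    obtain ⟨N, hNW, haN, h, hN⟩ := hA.exists_isTwoSidedBox ha
      (inter_mem hW (hD.isOpen_compl.mem_nhds (hAD' ha)))
    refine ⟨N, fun x hx ↦ (hNW hx).1, haN, h, { hN with mem_iff := fun x hx ↦ ?_ }⟩
    rw [← hN.mem_iff x hx]
    refine ⟨fun hxB ↦ by_contra fun hxA ↦ (hNW hx).2 ?_, fun h ↦ hAB h⟩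
    rw [hDB]
    exact ⟨hxB, hxA⟩
  have hdense : Dense Bᶜ := by
    have h1 : A ⊆ closure Bᶜ := fun a ha ↦ by
      obtain ⟨N, -, haN, h, hN⟩ := hbox ha univ_mem
      exact closure_mono hN.pos_subset (hN.mem_closure_pos a haN ((hN.mem_iff a haN).1 (hAB ha)))
    refine fun x ↦ (em (x ∈ B)).elim (fun hx ↦ closure_minimal h1 isClosed_closure hx)
      (fun hx ↦ subset_closure hx)
  obtain ⟨x₀, hx₀⟩ : ∃ x₀, F x₀ ∈ Bᶜ := by
    obtain ⟨x⟩ : Nonempty X := inferInstance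
    exact (hdense.preimage hFl.isOpenMap).nonempty_iff.2 ⟨x⟩
  obtain ⟨ℓ, hℓ⟩ := (hcov.mono hBD).exists_isSheetLabel hFl hBU hx₀
  have hd := hcover.2 (F x₀) (hBD hx₀)
  have hA' : HasCrossingBoxes F ℓ B A := fun a ha W hW ↦ by
    obtain ⟨V, hVo, haV, hV⟩ := hcov.exists_isSectionOn (hAD' ha)
    obtain ⟨N, hNW, haN, h, hN⟩ := hbox ha (inter_mem hW (hVo.mem_nhds haV))
    refine ⟨N, fun x hx ↦ (hNW hx).1, haN, h, hN.exists_isCrossingBox hFl hℓ haN (hAB ha) ?_⟩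
    intro x hx
    obtain ⟨t, ht, htx⟩ := hV x (hNW hx).2
    exact ⟨t, ht.mono fun y hy ↦ (hNW hy).2, htx⟩
  obtain ⟨σ₀, hσ₀⟩ := hA'.exists_perm hℓ hAB hAconn
  obtain ⟨D₀, hDD₀, -, hcodim, hhalf⟩ := hAD.regular
  have hD₀D : D₀ ⊆ D := hDD₀ ▸ subset_closure
  have hD₀box {p} (hp : p ∈ D₀) {W} (hW : W ∈ 𝓝 p) := hhalf.exists_box hp hW
  -- `D₀` is relatively open in its closure `D`, by the half-space charts.
  have hZc : IsClosed (D \ D₀) := by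
    rw [← isOpen_compl_iff, isOpen_iff_mem_nhds]
    intro p hp
    by_cases hpD : p ∈ D
    · have hp₀ : p ∈ D₀ := by_contra fun h ↦ hp ⟨hpD, h⟩
      obtain ⟨V, -, hVo, hpV, -, -, hV⟩ := hD₀box hp₀ univ_mem
      filter_upwards [hVo.mem_nhds hpV] with q hq hqZ
      exact hqZ.2 (hV ⟨hq, hDD₀ ▸ hqZ.1⟩)
    · filter_upwards [hD.isOpen_compl.mem_nhds hpD] with q hq hqZ using hq hqZ.1
  have htrans : ∀ O, (∀ s, σ₀ s ∈ O ↔ s ∈ O) → O = ∅ ∨ O = univ := by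
    refine hℓ.eq_empty_or_eq_univ hFl hdense (D₀ := D₀) (Z := D \ D₀) (fun y hy ↦ ?_)
      (fun y hy ↦ (hDB ▸ hy.1 : y ∈ B \ A).1) hA' ?_ ?_ hσ₀
    · by_cases hyA : y ∈ A
      · exact .inl (.inl hyA)
      · have hyD : y ∈ D := hDB ▸ ⟨hy, hyA⟩
        by_cases hy₀ : y ∈ D₀
        exacts [.inl (.inr hy₀), .inr ⟨hyD, hy₀⟩]
    · intro p hp W hW
      obtain ⟨V, hVW, hVo, hpV, hV, -, -⟩ := hD₀box hp hW
      exact ⟨V, hVW, hVo, hpV, hV⟩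
    · intro p hp W hW
      obtain ⟨r, hr, hrW⟩ := Metric.mem_nhds_iff.1 hW
      refine ⟨Metric.ball p r, hrW, Metric.isOpen_ball, Metric.mem_ball_self hr,
        (convex_ball p r).isPreconnected_diff_of_dimH_lt Metric.isOpen_ball hZc ?_⟩
      have h4 := hcodim ⟨p, hp⟩
      have hfin : dimH (D \ D₀) ≠ ⊤ :=
        ne_top_of_le_ne_top (ENNReal.natCast_ne_top n) (le_self_add.trans h4)
      rw [finrank_euclideanSpace_fin]
      -- Codimension greater than one is enough here; finiteness of the dimension makes the
      -- inequality strict.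
      exact (ENNReal.add_lt_add_left hfin (by norm_num)).trans_le h4
  have hDn : D.Nonempty := by
    obtain ⟨a, ha⟩ := hAconn.nonempty
    obtain ⟨-, ⟨⟨y, hy, -⟩, -⟩, -⟩ := hAD.component a (hAB ha)
    exact ⟨y, hy⟩
  by_cases hFD : ∃ x, F x ∈ D
  · left
    obtain ⟨x, hx⟩ : ∃ x, F x ∈ D₀ := by
      obtain ⟨x, hx⟩ := hFD
      rw [hDD₀] at hx
      obtain ⟨-, ⟨x', rfl⟩, hx'⟩ := mem_closure_iff.1 hx _ hFl.isOpenMap.isOpen_range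
        (mem_range_self x)
      exact ⟨x', hx'⟩
    -- Near `x` only one label `s` occurs, also on both sides of `A` close to the edge; crossing
    -- there must fix `s`.
    obtain ⟨s, hs⟩ := hℓ.exists_eventually_eq_of_isPreconnected hFl (x := x) fun W hW ↦ by
      obtain ⟨V, hVW, hVo, hpV, hV, -, -⟩ := hD₀box hx hW
      exact ⟨V, hVW, hVo, hpV, hV⟩
    obtain ⟨V, hVo, hxV, t, ht, htx, -⟩ := hFl.exists_isSectionOn x
    have htc : ContinuousAt t (F x) := ht.continuousOn.continuousAt (hVo.mem_nhds hxV)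
    have hnear : V ∩ {y | F (t y) ∈ Bᶜ → ℓ (t y) = s} ∈ 𝓝 (F x) :=
      inter_mem (hVo.mem_nhds hxV)
        (htc.eventually (p := fun x' ↦ F x' ∈ Bᶜ → ℓ x' = s) (by rwa [htx]))
    obtain ⟨V', hV'V, hV'o, hxV', -, ⟨a, haV', haB, haD₀⟩, hV'D⟩ := hD₀box hx hnear
    have haA : a ∈ A := by
      by_contra haA
      exact haD₀ (hV'D ⟨haV', hDD₀ ▸ hDB ▸ ⟨haB, haA⟩⟩)
    obtain ⟨N, hNV', haN, h, σ, hN⟩ := hA' a haA V' (hV'o.mem_nhds haV')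
    have ha0 := (hN.mem_iff a haN).1 haB
    obtain ⟨u, huN, hu⟩ := closure_nonempty_iff.1 ⟨a, hN.mem_closure_pos a haN ha0⟩
    obtain ⟨v, hvN, hv⟩ := closure_nonempty_iff.1 ⟨a, hN.mem_closure_neg a haN ha0⟩
    have htN : IsSectionOn F t N := ht.mono fun y hy ↦ (hV'V (hNV' hy)).1
    have hval {y} (hy : y ∈ N) (hyB : y ∈ Bᶜ) : ℓ (t y) = s :=
      (hV'V (hNV' hy)).2 (by rwa [htN.apply_eq y hy])
    have hfix := hN.crossing t htN u huN v hvN hu hv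
    rw [hval huN (hN.pos_subset ⟨huN, hu⟩), hval hvN (hN.neg_subset ⟨hvN, hv⟩)] at hfix
    rw [← hd]
    refine encard_eq_one_of_transitive_of_fixed htrans (s := s) ?_
    obtain rfl | rfl := hσ₀ N h σ hN ⟨a, haN, haA⟩
    · exact hfix.symm
    · rwa [eq_comm, Equiv.Perm.inv_eq_iff_eq, eq_comm] at hfix
  · by_cases hinv : σ₀ = σ₀⁻¹
    · have h2 := encard_le_two_of_transitive_of_eq_inv htrans hinv ⟨x₀, rfl⟩
      have h1 : 1 ≤ (F ⁻¹' {F x₀}).encard := one_le_encard_iff_nonempty.2 ⟨x₀, rfl⟩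
      rw [hd] at h1 h2
      have hdt : d ≠ ⊤ := ne_top_of_le_ne_top (by decide) h2
      lift d to ℕ using hdt
      norm_cast at h1 h2 ⊢
      lia
    · right; right
      rw [← hd]
      by_contra hfin
      rw [encard_eq_top_iff, not_infinite] at hfin
      have : Finite (F ⁻¹' {F x₀}) := hfin
      have : Nonempty (F ⁻¹' {F x₀}) := ⟨⟨x₀, rfl⟩⟩
      obtain ⟨γ, hγ⟩ := hℓ.exists_height hX hFl isClosed_closure hdense hAB
        (fun x hx ↦ by_contra fun hxA ↦ hFD ⟨x, hDB ▸ ⟨hx, hxA⟩⟩) hA' hAconn.nonempty hσ₀ hinv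
      -- The sheet of greatest height is contradicted by its image under `σ₀`.
      obtain ⟨s, hs⟩ := Finite.exists_max γ
      have := hs (σ₀ s)
      rw [hγ] at this
      lia
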